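/- Let $c>0$ and let $t\ge 0$ be a fixed integer. Let $X(n,c/n)$ be the clique complex of the Erdős–Rényi random graph $G(n,c/n)$ on $n$ vertices (for $n<c$ the edge probability is read as $1$). A vertex $v$ of a simplicial complex $K$ is *dominated* if its link in $K$ is a simplicial cone $aL$, that is, $L$ is a subcomplex of $K$ not containing the vertex $a\neq v$, and the link consists of $a$, the simplices of $L$ and the simplices $\sigma\cup\{a\}$ with $\sigma\in L$. A *pruning phase* run on $K$ removes simultaneously all dominated vertices of $K$, together with all simplices containing them; $R_t(K)$ denotes the result of $t$ successive pruning phases. Let $f_0(K)$ be the set of non-isolated vertices of $K$, i.e. of those that lie in an edge of $K$. Let $\gamma_0=0$ and, for $t\ge 1$, let $\gamma_t$ be the probability that the Galton–Watson tree with Poisson($c$) offspring, grown for $t$ generations from the root, is reduced to its root by at most $t-1$ steps, where each step removes simultaneously all leaves other than the root. Then $\gamma_{s+1}=e^{-c(1-\gamma_s)}$ for all $s\ge 0$, and for $X\sim X(n,c/n)$ $$\mathbb{E}\,|f_0(R_t(X))|=\left(1-\gamma_{t+1}-c\gamma_t+c\gamma_t^2\right)n+o(n)\qquad (n\to\infty).$$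 The same holds, for every choice of $R_t(X)$ as a function of $X$, if some dominated vertices may be kept in a phase: each phase run on $K$ removes simultaneously a set $S$ of dominated vertices of $K$ such that no dominated vertex of $K$ outside $S$ is still dominated after $S$ has been removed. -/

import Mathlib

open MeasureTheory ProbabilityTheory Filter Asymptotics
open scoped NNReal

namespace StrongCollapse

section Complexes

variable {V : Type*} [DecidableEq V]

/-- The clique (flag) complex of a graph: its simplices are the nonempty finite cliques. -/
def cliqueComplex (G : SimpleGraph V) : PreAbstractSimplicialComplex V where
  faces := {s | s.Nonempty ∧ G.IsClique (s : Set V)}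
  isRelLowerSet_faces := fun _ hs =>
    ⟨hs.1, fun _ hb hne => ⟨hne, hs.2.subset (Finset.coe_subset.2 hb)⟩⟩

/-- The link of `σ` in `K`: the simplices `τ` of `K` disjoint from `σ` with `τ ∪ σ` in `K`. -/
def link (K : PreAbstractSimplicialComplex V) (σ : Finset V) : PreAbstractSimplicialComplex V where
  faces := {τ | τ ∈ K ∧ τ ∪ σ ∈ K ∧ Disjoint τ σ}
  isRelLowerSet_faces := by
    rintro τ ⟨h₁, h₂, h₃⟩
    refine ⟨(K.isRelLowerSet_faces h₁).1, fun ρ hρ hne => ⟨?_, ?_, h₃.mono_left hρ⟩⟩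
    · exact (K.isRelLowerSet_faces h₁).2 hρ hne
    · exact (K.isRelLowerSet_faces h₂).2 (Finset.union_subset_union_left hρ)
        (hne.mono Finset.subset_union_left)

/-- The simplicial cone `aL`: the vertex `a`, the simplices of `L`, and all `σ ∪ {a}`
with `σ` a simplex of `L`. -/
def cone (a : V) (L : PreAbstractSimplicialComplex V) : PreAbstractSimplicialComplex V where
  faces := {τ | τ = {a} ∨ τ ∈ L ∨ ∃ σ ∈ L, τ = insert a σ}
  isRelLowerSet_faces := by
    rintro τ (rfl | h | ⟨σ, hσ, rfl⟩)
    · refine ⟨Finset.singleton_nonempty a, fun ρ hρ hne => Or.inl ?_⟩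
      exact (Finset.subset_singleton_iff.1 hρ).resolve_left hne.ne_empty
    · exact ⟨(L.isRelLowerSet_faces h).1,
        fun ρ hρ hne => Or.inr (Or.inl ((L.isRelLowerSet_faces h).2 hρ hne))⟩
    · refine ⟨Finset.insert_nonempty a σ, fun ρ hρ hne => ?_⟩
      have hsub : ρ.erase a ⊆ σ := Finset.subset_insert_iff.1 hρ
      by_cases ha : a ∈ ρ
      · rcases (ρ.erase a).eq_empty_or_nonempty with he | he
        · left
          rw [← Finset.insert_erase ha, he]
          rfl
        · exact Or.inr (Or.inr ⟨ρ.erase a, (L.isRelLowerSet_faces hσ).2 hsub he,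
            (Finset.insert_erase ha).symm⟩)
      · rw [Finset.erase_eq_of_notMem ha] at hsub
        exact Or.inr (Or.inl ((L.isRelLowerSet_faces hσ).2 hsub hne))

/-- A simplex `σ` of `K` is dominated if its link is a simplicial cone `aL`, with apex `a ∉ σ`
and base a subcomplex `L` of `K` not containing the vertex `a`. -/
def IsDominated (K : PreAbstractSimplicialComplex V) (σ : Finset V) : Prop :=
  σ ∈ K ∧ ∃ a, a ∉ σ ∧ ∃ L : PreAbstractSimplicialComplex V, L ≤ K ∧ {a} ∉ L ∧
    link K σ = cone a L

/-- The set of dominated vertices of `K`. -/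
def dominatedVertices (K : PreAbstractSimplicialComplex V) : Set V :=
  {v | IsDominated K {v}}

/-- The complex left after removing all vertices in `S`, with all simplices containing them. -/
def deleteVertices (K : PreAbstractSimplicialComplex V) (S : Set V) :
    PreAbstractSimplicialComplex V where
  faces := {τ | τ ∈ K ∧ ∀ v ∈ τ, v ∉ S}
  isRelLowerSet_faces := fun _ h =>
    ⟨(K.isRelLowerSet_faces h.1).1, fun _ hρ hne =>
      ⟨(K.isRelLowerSet_faces h.1).2 hρ hne, fun v hv => h.2 v (hρ hv)⟩⟩

/-- One pruning phase: all dominated vertices of `K` are removed simultaneously. -/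
def prune (K : PreAbstractSimplicialComplex V) : PreAbstractSimplicialComplex V :=
  deleteVertices K (dominatedVertices K)

/-- A pruning phase with ties left open: when vertices dominate each other, some of them may be
kept. A set `S` of dominated vertices of `K` is removed simultaneously, and it is so large that
no dominated vertex of `K` outside `S` is still dominated after the removal. The choice
`S = dominatedVertices K` gives `prune`; a maximal set of dominated vertices of `K` that can be
removed one after the other by strong collapses is another choice. -/
def IsPruningPhase (K L : PreAbstractSimplicialComplex V) : Prop :=
  ∃ S ⊆ dominatedVertices K,
    (∀ v ∈ dominatedVertices K, v ∉ S → v ∉ dominatedVertices (deleteVertices K S)) ∧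
    L = deleteVertices K S

/-- `L` is obtained from `K` by `t` pruning phases with ties left open. -/
def IsPrunedTo : ℕ → PreAbstractSimplicialComplex V → PreAbstractSimplicialComplex V → Prop
  | 0, K, L => L = K
  | t + 1, K, L => ∃ M, IsPrunedTo t K M ∧ IsPruningPhase M L

/-- The non-isolated vertices of `K`: those that lie in an edge of `K`. -/
def nonIsolated (K : PreAbstractSimplicialComplex V) : Set V :=
  {v | {v} ∈ K ∧ ∃ w, w ≠ v ∧ {v, w} ∈ K}

end Complexes

/-- The edge probability `c / n`, truncated at `1` for the finitely many `n < c`. -/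
noncomputable def edgeProb (c : ℝ≥0) (n : ℕ) : unitInterval :=
  Set.projIcc 0 1 zero_le_one ((c : ℝ) / n)

/-- The expectation of `f G` for the Erdős–Rényi random graph `G` on `n` vertices with
edge probability `c / n`. -/
noncomputable def expectER (c : ℝ≥0) (n : ℕ) (f : SimpleGraph (Fin n) → ℝ) : ℝ :=
  ∫ G, f G ∂(SimpleGraph.binomialRandom (Fin n) (edgeProb c n))

section Trees

/-- The nodes of the family tree with offspring numbers `ω`: the root is the empty word, and the
children of the node `u` are `i :: u` with `i < ω u`. -/
def IsNode (ω : List ℕ → ℕ) : List ℕ → Prop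
  | [] => True
  | i :: u => IsNode ω u ∧ i < ω u

/-- The family tree after `t` iterations, given by its set of nodes. -/
def tree (ω : List ℕ → ℕ) (t : ℕ) : Set (List ℕ) :=
  {u | IsNode ω u ∧ u.length ≤ t}

/-- A root collapsing step: all leaves other than the root are removed. -/
def rootCollapse (T : Set (List ℕ)) : Set (List ℕ) :=
  {u | u ∈ T ∧ (u = [] ∨ ∃ i, i :: u ∈ T)}

/-- The law of independent Poisson(`c`) offspring numbers. -/
noncomputable def offspringLaw (c : ℝ≥0) : Measure (List ℕ → ℕ) :=
  Measure.infinitePi fun _ => poissonMeasure c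

/-- `gamma c t` is the probability that the Poisson(`c`) tree after `t` iterations is pruned to its
root by at most `t - 1` root collapsing steps (extra steps do not change a single root), and
`gamma c 0 = 0`. -/
noncomputable def gamma (c : ℝ≥0) : ℕ → ℝ
  | 0 => 0
  | t + 1 => (offspringLaw c).real {ω | rootCollapse^[t] (tree ω (t + 1)) = {[]}}

end Trees

end StrongCollapse

/-! Around a typical vertex the graph is a tree, and in a tree a vertex is dominated exactly when it
is a leaf: a vertex with two non-adjacent neighbours left has no apex adjacent or equal to both. So
a pruning phase removes leaves. Ties occur at isolated edges, and every admissible choice destroys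
such an edge, so the set of non-isolated vertices does not feel the choice.

`Dies G s X u` is the analogue in the graph of extinction by generation `s`. If the ball around `v`
is tree-like, then after `t = s + 1` phases `v` still has an edge iff some branch at `v` survives
`t` rounds of leaf removal, except when all other branches die within `s` rounds: then `v` has
become a leaf by the last phase (`mem_nonIsolated_iff`). This is deterministic.

For the probabilities, the edges at `v` are independent of the graph without `v`. Given that `Z`
branches survive `s` rounds there, `v` dies in `s + 1` rounds with probability `(1 - p) ^ Z`
(`expect_dies_succ_mul`). A second moment argument by induction on `s` shows that `Z / n`
concentrates at `1 - γ_s` (`eventually_expect_abs_survivors_le`), and `(1 - c/n) ^ Z` then tends to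
`exp (-c (1 - γ_s)) = γ_{s+1}`. The exceptional case has limiting probability `c (1 - γ_t) exp (-c
(1 - γ_s)) = c (1 - γ_t) γ_t` and is disjoint from `v` dying, which gives `1 - γ_{t+1} - c γ_t + c
γ_t²`. Failure of tree-likeness costs `O(1/n)` per vertex (`expect_not_treeLike_le`), and linearity
of expectation finishes. -/

namespace StrongCollapse

/-! ### Extinction probabilities of the Poisson Galton–Watson tree -/

section GaltonWatson

/-- The offspring numbers of the descendants of the child `i` of the root. -/
def childOffspring (i : ℕ) (ω : List ℕ → ℕ) : List ℕ → ℕ := fun u => ω (u ++ [i])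

theorem isNode_append_singleton {ω : List ℕ → ℕ} {u : List ℕ} {i : ℕ} :
    IsNode ω (u ++ [i]) ↔ i < ω [] ∧ IsNode (childOffspring i ω) u := by
  induction u with
  | nil => simp [IsNode]
  | cons j u ih =>
    simp only [List.cons_append, IsNode, ih, childOffspring]
    tauto

/-- A collapse deletes the ends of the descending paths, so each one shortens the longest path below
a node by one. Words grow at the head, hence `w ++ u` is a descendant of `u`. -/
theorem mem_rootCollapse_iterate {ω : List ℕ → ℕ} {m k : ℕ} {u : List ℕ} :
    u ∈ rootCollapse^[k] (tree ω m) ↔ u = [] ∨ ∃ w : List ℕ, w.length = k ∧ w ++ u ∈ tree ω m := by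
  induction k generalizing u with
  | zero =>
    constructor
    · exact fun h => Or.inr ⟨[], rfl, h⟩
    · rintro (rfl | ⟨w, hw, h⟩)
      · exact ⟨trivial, Nat.zero_le _⟩
      · simpa [List.length_eq_zero_iff.1 hw] using h
  | succ k ih =>
    rw [Function.iterate_succ_apply']
    constructor
    · rintro ⟨-, rfl | ⟨i, hi⟩⟩
      · exact Or.inl rfl
      · obtain h | ⟨w, hw, h⟩ := ih.1 hi
        · simp at h
        · exact Or.inr ⟨w ++ [i], by simp [hw], by simpa using h⟩
    · rintro (rfl | ⟨w, hw, h⟩)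
      · exact ⟨ih.2 (Or.inl rfl), Or.inl rfl⟩
      -- The head of `w` is its deepest letter: dropping it gives a descendant of `u` only `k`
      -- generations down. The last letter of `w` names the child of `u` on the way.
      · refine ⟨ih.2 (Or.inr ⟨w.tail, by simp [hw], ?_⟩), Or.inr ?_⟩
        · obtain _ | ⟨a, w⟩ := w
          · simp at hw
          · refine ⟨h.1.1, ?_⟩
            have := h.2
            simp only [List.cons_append, List.length_cons] at this
            simp only [List.tail_cons]
            omega
        · obtain rfl | ⟨w', i, rfl⟩ := List.eq_nil_or_concat w
          · simp at hw
          · exact ⟨i, ih.2 (Or.inr ⟨w', by simpa using hw, by simpa using h⟩)⟩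

/-- The offspring numbers for which the family tree has no individuals in generation `s`. -/
def extinctBy (s : ℕ) : Set (List ℕ → ℕ) := {ω | ∀ u : List ℕ, u.length = s → ¬ IsNode ω u}

/-- A child of the root outlasts `t` collapses iff it has a descendant `t` generations below it,
that is, in generation `t + 1`, where the tree is cut off. -/
theorem rootCollapse_iterate_eq_singleton_iff {ω : List ℕ → ℕ} {t : ℕ} :
    rootCollapse^[t] (tree ω (t + 1)) = {[]} ↔ ω ∈ extinctBy (t + 1) := by
  constructor
  · intro h u hu hn
    obtain rfl | ⟨w, i, rfl⟩ := List.eq_nil_or_concat u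
    · simp at hu
    · have : [i] ∈ rootCollapse^[t] (tree ω (t + 1)) :=
        mem_rootCollapse_iterate.2 (Or.inr ⟨w, by simpa using hu, by simpa using hn, by
          simpa using hu.le⟩)
      rw [h] at this
      simp at this
  · intro h
    ext u
    rw [mem_rootCollapse_iterate, Set.mem_singleton_iff, or_iff_left_iff_imp]
    rintro ⟨w, hw, hn, hl⟩
    by_contra hu
    refine h (w ++ u) ?_ hn
    have := List.length_pos_of_ne_nil hu
    rw [List.length_append] at hl ⊢
    omega

theorem extinctBy_zero : extinctBy 0 = ∅ :=
  Set.eq_empty_of_forall_notMem fun _ h => h [] rfl trivial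

theorem mem_extinctBy_succ {s : ℕ} {ω : List ℕ → ℕ} :
    ω ∈ extinctBy (s + 1) ↔ ∀ i < ω [], childOffspring i ω ∈ extinctBy s := by
  constructor
  · intro h i hi u hu hn
    exact h (u ++ [i]) (by simp [hu]) (isNode_append_singleton.2 ⟨hi, hn⟩)
  · intro h u hu hn
    obtain rfl | ⟨w, i, rfl⟩ := List.eq_nil_or_concat u
    · simp at hu
    · rw [List.concat_eq_append, isNode_append_singleton] at hn
      exact h i hn.1 w (by simpa using hu) hn.2

theorem measurableSet_isNode (u : List ℕ) : MeasurableSet {ω : List ℕ → ℕ | IsNode ω u} := by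
  induction u with
  | nil => simp [IsNode]
  | cons i u ih =>
    exact ih.inter (measurableSet_lt measurable_const (measurable_pi_apply u))

theorem measurableSet_extinctBy (s : ℕ) : MeasurableSet (extinctBy s) := by
  have : extinctBy s = ⋂ u : List ℕ, ⋂ _ : u.length = s, {ω | IsNode ω u}ᶜ := by
    ext ω
    simp [extinctBy]
  rw [this]
  exact .iInter fun u => .iInter fun _ => (measurableSet_isNode u).compl

/-- The index sets of the blocks of nodes: the root, and the descendants of each child. -/
def Block : Option ℕ → Type
  | none => Unit
  | some _ => List ℕ

/-- The node described by a block and an index in it. -/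
def blockNode : (Σ j, Block j) → List ℕ
  | ⟨none, _⟩ => []
  | ⟨some i, u⟩ => (show List ℕ from u) ++ [i]

theorem blockNode_injective : Function.Injective blockNode := by
  rintro ⟨_ | i, u⟩ ⟨_ | j, w⟩ h
  · rfl
  · exact absurd h.symm (List.append_ne_nil_of_right_ne_nil _ (List.cons_ne_nil _ _))
  · exact absurd h (List.append_ne_nil_of_right_ne_nil _ (List.cons_ne_nil _ _))
  · obtain ⟨h₁, h₂⟩ := List.append_inj' (show (_ : List ℕ) ++ [i] = _ ++ [j] from h) rfl
    obtain rfl : i = j := by simpa using h₂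
    congr

/-- The branching property: the root and the subtrees of its children use disjoint sets of
coordinates, so they are independent, and each subtree has the law of the whole tree. -/
theorem map_blocks_offspringLaw (c : ℝ≥0) :
    (offspringLaw c).map (fun ω j (k : Block j) => ω (blockNode ⟨j, k⟩)) =
      Measure.infinitePi fun j : Option ℕ => Measure.infinitePi fun _ : Block j =>
        poissonMeasure c := by
  have h := Measure.map_infinitePi_infinitePi_of_inj (P := fun _ : List ℕ => poissonMeasure c)
    blockNode_injective
  rw [← Measure.infinitePi_map_piCurry (fun (j : Option ℕ) (_ : Block j) => poissonMeasure c), ← h,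
    Measure.map_map (by fun_prop) (by fun_prop)]
  rfl

theorem offspringLaw_extinctBy_succ_inter (c : ℝ≥0) (s k : ℕ) :
    offspringLaw c (extinctBy (s + 1) ∩ {ω | ω [] = k}) =
      poissonMeasure c {k} * offspringLaw c (extinctBy s) ^ k := by
  classical
  let B : (j : Option ℕ) → Set (Block j → ℕ) := fun j =>
    match j with
    | none => {f | f () = k}
    | some _ => extinctBy s
  have hB : ∀ j, MeasurableSet (B j) := by
    rintro (_ | i)
    · exact measurable_pi_apply (X := fun _ : Unit => ℕ) () (measurableSet_singleton k)
    · exact measurableSet_extinctBy s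
  let J : Finset (Option ℕ) := Finset.insertNone (Finset.range k)
  have key := Measure.infinitePi_pi (s := J) (t := B)
    (fun j : Option ℕ => Measure.infinitePi fun _ : Block j => poissonMeasure c) (fun j _ => hB j)
  rw [← map_blocks_offspringLaw, Measure.map_apply (by fun_prop)
    (.pi J.countable_toSet fun j _ => hB j)] at key
  convert key using 1
  · congr 1
    ext ω
    simp only [Set.mem_inter_iff, mem_extinctBy_succ, Set.mem_ofPred_eq, Set.mem_preimage,
      Set.mem_pi]
    constructor
    · rintro ⟨h, hk⟩ (_ | i) hj
      · exact hk
      · refine h i ?_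
        rw [hk]
        simpa [J] using hj
    · intro h
      have hk : ω [] = k := h none (by simp [J])
      refine ⟨fun i hi => h (some i) ?_, hk⟩
      simpa [J, ← hk] using hi
  · have h1 : (Measure.infinitePi fun _ : Block none => poissonMeasure c) (B none) =
        poissonMeasure c {k} := by
      have := Measure.infinitePi_map_eval (fun _ : Unit => poissonMeasure c) ()
      conv_rhs => rw [← this]
      rw [Measure.map_apply (by fun_prop) (measurableSet_singleton k)]
      rfl
    rw [Finset.prod_insertNone, h1]
    congr 1
    have h2 := Finset.prod_const (s := Finset.range k) (offspringLaw c (extinctBy s))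
    rw [Finset.card_range] at h2
    exact h2.symm

/-- Summing over the number `k` of children of the root evaluates the Poisson generating function
`exp (-c (1 - q))` at the extinction probability `q` of one subtree. -/
theorem offspringLaw_real_extinctBy_succ (c : ℝ≥0) (s : ℕ) :
    (offspringLaw c).real (extinctBy (s + 1)) =
      Real.exp (-(c : ℝ) * (1 - (offspringLaw c).real (extinctBy s))) := by
  have : IsProbabilityMeasure (offspringLaw c) := by unfold offspringLaw; infer_instance
  set q := (offspringLaw c).real (extinctBy s) with hq
  have hsum : HasSum (fun k => (offspringLaw c).real (extinctBy (s + 1) ∩ {ω | ω [] = k}))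
      ((offspringLaw c).real (extinctBy (s + 1))) := by
    have hU : extinctBy (s + 1) = ⋃ k, extinctBy (s + 1) ∩ {ω | ω [] = k} := by
      ext ω
      simp
    have hm : offspringLaw c (extinctBy (s + 1)) =
        ∑' k, offspringLaw c (extinctBy (s + 1) ∩ {ω | ω [] = k}) := by
      conv_lhs => rw [hU]
      refine measure_iUnion (fun i j hij => Set.disjoint_left.2 ?_) fun k => ?_
      · rintro ω ⟨-, hi⟩ ⟨-, hj⟩
        exact hij (hi.symm.trans hj)
      · exact (measurableSet_extinctBy _).inter 
          (measurable_pi_apply (X := fun _ : List ℕ => ℕ) [] (measurableSet_singleton k))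
    have hs := ENNReal.hasSum_toReal (hm ▸ measure_ne_top (offspringLaw c) (extinctBy (s + 1)))
    rwa [← ENNReal.tsum_toReal_eq (fun _ => measure_ne_top _ _), ← hm] at hs
  have hexp : HasSum (fun k : ℕ => Real.exp (-(c : ℝ)) * ((c * q) ^ k / k.factorial))
      (Real.exp (-(c : ℝ)) * Real.exp (c * q)) := by
    rw [Real.exp_eq_exp_ℝ]
    exact (NormedSpace.expSeries_div_hasSum_exp (c * q : ℝ)).mul_left _
  rw [← Real.exp_add] at hexp
  rw [show -(c : ℝ) * (1 - q) = -c + c * q by ring]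
  refine hsum.unique ?_
  convert hexp using 2 with k
  rw [measureReal_def, offspringLaw_extinctBy_succ_inter, ENNReal.toReal_mul, ENNReal.toReal_pow,
    ← measureReal_def, ← measureReal_def, poissonMeasure_real_singleton, ← hq, mul_pow]
  ring

theorem gamma_eq_extinctBy (c : ℝ≥0) (s : ℕ) :
    gamma c s = (offspringLaw c).real (extinctBy s) := by
  cases s with
  | zero => simp [gamma, extinctBy_zero]
  | succ t => simp only [gamma, rootCollapse_iterate_eq_singleton_iff, Set.ofPred_mem_eq]

theorem gamma_succ (c : ℝ≥0) (s : ℕ) :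
    gamma c (s + 1) = Real.exp (-(c : ℝ) * (1 - gamma c s)) := by
  simp only [gamma_eq_extinctBy, offspringLaw_real_extinctBy_succ]

theorem gamma_nonneg (c : ℝ≥0) (s : ℕ) : 0 ≤ gamma c s := by
  rw [gamma_eq_extinctBy]
  exact measureReal_nonneg

theorem gamma_le_one (c : ℝ≥0) (s : ℕ) : gamma c s ≤ 1 := by
  have : IsProbabilityMeasure (offspringLaw c) := by unfold offspringLaw; infer_instance
  rw [gamma_eq_extinctBy]
  exact measureReal_le_one

end GaltonWatson

/-! ### Pruning phases on tree-like neighbourhoods (deterministic) -/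

section LocalStructure

variable {V : Type*} {G : SimpleGraph V}

theorem mem_deleteVertices_cliqueComplex {A : Set V} {τ : Finset V} :
    τ ∈ deleteVertices (cliqueComplex G) A ↔
      (τ.Nonempty ∧ G.IsClique (τ : Set V)) ∧ ∀ v ∈ τ, v ∉ A := Iff.rfl

theorem singleton_mem_deleteVertices_cliqueComplex {A : Set V} {v : V} :
    {v} ∈ deleteVertices (cliqueComplex G) A ↔ v ∉ A := by
  simp [mem_deleteVertices_cliqueComplex]

theorem deleteVertices_deleteVertices (K : PreAbstractSimplicialComplex V) (A S : Set V) :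
    deleteVertices (deleteVertices K A) S = deleteVertices K (A ∪ S) := by
  refine SetLike.ext fun τ => ?_
  change ((τ ∈ K ∧ _) ∧ _) ↔ (τ ∈ K ∧ _)
  simp only [Set.mem_union, not_or]
  exact ⟨fun h => ⟨h.1.1, fun v hv => ⟨h.1.2 v hv, h.2 v hv⟩⟩,
    fun h => ⟨⟨h.1, fun v hv => (h.2 v hv).1⟩, fun v hv => (h.2 v hv).2⟩⟩

theorem deleteVertices_empty (K : PreAbstractSimplicialComplex V) :
    deleteVertices K ∅ = K := by
  refine SetLike.ext fun τ => ?_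
  change (τ ∈ K ∧ _) ↔ _
  simp

variable [DecidableEq V]

/-- The branch at `u` of the graph with the explored vertices `X` removed dies out in `s` rounds
of leaf removal: it contains no path with `s` edges that starts in `u`. -/
def Dies (G : SimpleGraph V) : ℕ → Finset V → V → Prop
  | 0, _, _ => False
  | s + 1, X, u => ∀ w, G.Adj u w → w ∉ X → Dies G s (insert u X) w

/-- The paths with at most `s` vertices that start in `u`, avoid `X` and continue a path on `X`
ending in `x` have no chords. -/
def TreeLike (G : SimpleGraph V) : ℕ → Finset V → V → V → Prop
  | 0, _, _, _ => True
  | s + 1, X, x, u => (∀ y ∈ X, G.Adj u y → y = x) ∧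
      ∀ w, G.Adj u w → w ∉ X → TreeLike G s (insert u X) u w

theorem Dies.succ {s : ℕ} {X : Finset V} {u : V} (h : Dies G s X u) : Dies G (s + 1) X u := by
  induction s generalizing X u with
  | zero => exact h.elim
  | succ s ih => exact fun w hw hX => ih (h w hw hX)

theorem Dies.mono {s t : ℕ} (hst : s ≤ t) {X : Finset V} {u : V} (h : Dies G s X u) :
    Dies G t X u := by
  induction hst with
  | refl => exact h
  | step _ ih => exact ih.succ

theorem TreeLike.of_succ {s : ℕ} {X : Finset V} {x u : V} (h : TreeLike G (s + 1) X x u) :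
    TreeLike G s X x u := by
  induction s generalizing X x u with
  | zero => trivial
  | succ s ih => exact ⟨h.1, fun w hw hX => ih (h.2 w hw hX)⟩

theorem TreeLike.mono {s t : ℕ} (hst : s ≤ t) {X : Finset V} {x u : V}
    (h : TreeLike G t X x u) : TreeLike G s X x u := by
  induction hst with
  | refl => exact h
  | step _ ih => exact ih h.of_succ

theorem pair_mem_deleteVertices_cliqueComplex {A : Set V} {v w : V} (h : v ≠ w) :
    {v, w} ∈ deleteVertices (cliqueComplex G) A ↔ G.Adj v w ∧ v ∉ A ∧ w ∉ A := by
  simp [mem_deleteVertices_cliqueComplex, h]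

theorem exists_eq_deleteVertices_of_isPrunedTo {K : PreAbstractSimplicialComplex V} {t : ℕ}
    {L : PreAbstractSimplicialComplex V} (h : IsPrunedTo t K L) :
    ∃ A, L = deleteVertices K A := by
  induction t generalizing L with
  | zero => exact ⟨∅, by rw [deleteVertices_empty]; exact h⟩
  | succ t ih =>
    obtain ⟨M, hM, S, -, -, rfl⟩ := h
    obtain ⟨A, rfl⟩ := ih hM
    exact ⟨A ∪ S, deleteVertices_deleteVertices K A S⟩

theorem isPrunedTo_iterate_prune (K : PreAbstractSimplicialComplex V) (t : ℕ) :
    IsPrunedTo t K (prune^[t] K) := by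
  induction t with
  | zero => exact rfl
  | succ t ih =>
    rw [Function.iterate_succ_apply']
    exact ⟨_, ih, _, subset_rfl, fun v hv hS => absurd hv hS, rfl⟩

/-- The link is then the single point `x`, which is the cone over the empty complex. -/
theorem isDominated_of_unique_neighbor {A : Set V} {u x : V} (hu : u ∉ A) (hx : x ∉ A)
    (hux : G.Adj u x) (h : ∀ y, G.Adj u y → y ∉ A → y = x) :
    IsDominated (deleteVertices (cliqueComplex G) A) {u} := by
  refine ⟨singleton_mem_deleteVertices_cliqueComplex.2 hu, x, by simpa using hux.ne',
    ⟨∅, fun _ h => h.elim⟩, fun _ h => h.elim, fun h => h.elim, SetLike.ext fun τ => ?_⟩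
  constructor
  · rintro ⟨h₁, h₂, h₃⟩
    refine Or.inl ?_
    rw [mem_deleteVertices_cliqueComplex] at h₁ h₂
    refine Finset.eq_singleton_iff_nonempty_unique_mem.2 ⟨h₁.1.1, fun y hy => ?_⟩
    have hyu : u ≠ y := fun e => Finset.disjoint_singleton_right.1 h₃ (e ▸ hy)
    exact h y (h₂.1.2 (by simp) (by simp [hy]) hyu) (h₁.2 y hy)
  · rintro (rfl | h | ⟨σ, h, -⟩)
    · refine ⟨singleton_mem_deleteVertices_cliqueComplex.2 hx, ?_, ?_⟩
      · exact (pair_mem_deleteVertices_cliqueComplex hux.ne').2 ⟨hux.symm, hx, hu⟩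
      · simpa using hux.ne'
    · exact h.elim
    · exact h.elim

/-- Only this trace of domination on the graph is needed to show that a vertex is not dominated. -/
theorem exists_apex_of_isDominated {A : Set V} {u : V}
    (h : IsDominated (deleteVertices (cliqueComplex G) A) {u}) :
    ∃ a, G.Adj u a ∧ ∀ y, G.Adj u y → y ∉ A → y ≠ a → G.Adj y a := by
  obtain ⟨hu, a, ha, L, -, -, hL⟩ := h
  rw [singleton_mem_deleteVertices_cliqueComplex] at hu
  have haL : {a} ∈ link (deleteVertices (cliqueComplex G) A) {u} := by
    rw [hL]
    exact Or.inl rfl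
  have hau : a ≠ u := by simpa using ha
  refine ⟨a, ((pair_mem_deleteVertices_cliqueComplex hau).1 haL.2.1).1.symm, fun y hy hyA hya => ?_⟩
  have hyL : {y} ∈ link (deleteVertices (cliqueComplex G) A) {u} :=
    ⟨singleton_mem_deleteVertices_cliqueComplex.2 hyA,
      (pair_mem_deleteVertices_cliqueComplex hy.ne').2 ⟨hy.symm, hyA, hu⟩, by simpa using hy.ne'⟩
  rw [hL] at hyL
  obtain h | h | ⟨σ, -, h⟩ := hyL
  · exact absurd (Finset.singleton_injective h) hya
  · have : insert a {y} ∈ link (deleteVertices (cliqueComplex G) A) {u} := by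
      rw [hL]
      exact Or.inr (Or.inr ⟨_, h, rfl⟩)
    exact ((pair_mem_deleteVertices_cliqueComplex hya.symm).1 this.1).1.symm
  · exact absurd (Finset.mem_singleton.1 (h ▸ Finset.mem_insert_self a σ)).symm hya

/-- In a pruning phase, an edge that is the only one at its endpoint `u` loses an endpoint. -/
theorem not_both_survive_of_unique_neighbor {A S : Set V}
    (hmax : ∀ v ∈ dominatedVertices (deleteVertices (cliqueComplex G) A), v ∉ S →
      v ∉ dominatedVertices (deleteVertices (deleteVertices (cliqueComplex G) A) S))
    {u x : V} (hu : u ∉ A ∪ S) (hx : x ∉ A ∪ S) (hux : G.Adj u x)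
    (h : ∀ y, G.Adj u y → y ∉ A → y = x) : False := by
  refine hmax u (isDominated_of_unique_neighbor (fun hA => hu (Or.inl hA))
    (fun hA => hx (Or.inl hA)) hux h) (fun hS => hu (Or.inr hS)) ?_
  rw [deleteVertices_deleteVertices]
  exact isDominated_of_unique_neighbor hu hx hux fun y hy hyA => h y hy fun hA => hyA (Or.inl hA)

/-- Every branch beyond `u` dies one round sooner, so by induction all edges from `u` away from `x`
are lost one phase earlier. There are no chords back to `X`, so `ux` is the only edge at `u` when
the last phase begins. -/
theorem not_both_alive_of_dies {i : ℕ} {L : PreAbstractSimplicialComplex V}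
    (hL : IsPrunedTo i (cliqueComplex G) L) {X : Finset V} {x u : V} (hd : Dies G i X u)
    (ht : TreeLike G i X x u) (hux : G.Adj u x) : ¬ ({u} ∈ L ∧ {x} ∈ L) := by
  induction i generalizing L X x u with
  | zero => exact hd.elim
  | succ i ih =>
    obtain ⟨M, hM, S, -, hmax, rfl⟩ := hL
    obtain ⟨A, rfl⟩ := exists_eq_deleteVertices_of_isPrunedTo hM
    rw [deleteVertices_deleteVertices, singleton_mem_deleteVertices_cliqueComplex,
      singleton_mem_deleteVertices_cliqueComplex]
    rintro ⟨huA, hxA⟩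
    refine not_both_survive_of_unique_neighbor hmax huA hxA hux fun y hy hyA => ?_
    by_cases hyX : y ∈ X
    · exact ht.1 y hyX hy
    · refine absurd ⟨?_, ?_⟩ (ih hM (hd y hy hyX) (ht.2 y hy hyX) hy.symm)
      · exact singleton_mem_deleteVertices_cliqueComplex.2 hyA
      · exact singleton_mem_deleteVertices_cliqueComplex.2 fun hA => huA (Or.inl hA)

/-- While its parent `x` and a child `w` with a surviving branch are both present, `u` has two
non-adjacent neighbours and no apex can exist. Conditioning on `x` being present separates the fate
of the branch from that of the rest of the graph. -/
theorem alive_of_not_dies {i : ℕ} {L : PreAbstractSimplicialComplex V}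
    (hL : IsPrunedTo i (cliqueComplex G) L) {X : Finset V} {x u : V} (hd : ¬ Dies G i X u)
    (ht : TreeLike G (i + 1) X x u) (hux : G.Adj u x) (hxX : x ∈ X) (hx : {x} ∈ L) : {u} ∈ L := by
  induction i generalizing L X x u with
  | zero =>
    obtain rfl : L = cliqueComplex G := hL
    exact ⟨Finset.singleton_nonempty u, by simp⟩
  | succ i ih =>
    obtain ⟨M, hM, S, hS, -, rfl⟩ := hL
    obtain ⟨A, rfl⟩ := exists_eq_deleteVertices_of_isPrunedTo hM
    rw [deleteVertices_deleteVertices, singleton_mem_deleteVertices_cliqueComplex] at hx ⊢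
    have hxA : x ∉ A := fun h => hx (Or.inl h)
    have huM := ih hM (fun h => hd h.succ) ht.of_succ hux hxX
      (singleton_mem_deleteVertices_cliqueComplex.2 hxA)
    rw [singleton_mem_deleteVertices_cliqueComplex] at huM
    rintro (huA | huS)
    · exact huM huA
    obtain ⟨a, hua, ha⟩ := exists_apex_of_isDominated (hS huS)
    obtain ⟨w, huw, hwX, hw⟩ : ∃ w, G.Adj u w ∧ w ∉ X ∧ ¬ Dies G i (insert u X) w := by
      simpa [Dies] using hd
    have hwA := ih hM hw (ht.2 w huw hwX) huw.symm (Finset.mem_insert_self u X)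
      (singleton_mem_deleteVertices_cliqueComplex.2 huM)
    rw [singleton_mem_deleteVertices_cliqueComplex] at hwA
    have hno : ∀ z, G.Adj u z → z ∉ X → ¬ G.Adj z x := fun z huz hzX hzx =>
      hux.ne' ((ht.2 z huz hzX).1 x (Finset.mem_insert_of_mem hxX) hzx)
    -- The apex `x` would be adjacent to `w`; any other apex lies outside `X` and would be adjacent
    -- to `x`. Either way a chord appears.
    by_cases hax : a = x
    · subst hax
      exact hno w huw hwX (ha w huw hwA fun e => hwX (e ▸ hxX))
    · exact hno a hua (fun h => hax (ht.1 a h hua)) (ha x hux hxA (Ne.symm hax)).symm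

theorem TreeLike.of_root {s : ℕ} {v w : V} (ht : TreeLike G (s + 1) ∅ v v) (hw : G.Adj v w) :
    TreeLike G s {v} v w := by
  simpa using ht.2 w hw (by simp)

theorem TreeLike.not_adj_of_root {s : ℕ} {v w z : V} (ht : TreeLike G (s + 3) ∅ v v)
    (hw : G.Adj v w) (hz : G.Adj v z) : ¬ G.Adj w z := fun hwz =>
  hw.ne (((ht.of_root hw).2 z hwz (by simpa using hz.ne')).1 v (by simp) hz.symm)

/-- A vertex with two branches that survive `s` rounds of leaf removal survives `s + 1` pruning
phases. -/
theorem alive_of_two_branches {s i : ℕ} (hi : i ≤ s + 1) {L : PreAbstractSimplicialComplex V}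
    (hL : IsPrunedTo i (cliqueComplex G) L) {v w y : V} (ht : TreeLike G (s + 3) ∅ v v)
    (hvw : G.Adj v w) (hvy : G.Adj v y) (hyw : y ≠ w) (hw : ¬ Dies G s {v} w)
    (hy : ¬ Dies G s {v} y) : {v} ∈ L := by
  induction i generalizing L with
  | zero =>
    obtain rfl : L = cliqueComplex G := hL
    exact ⟨Finset.singleton_nonempty v, by simp⟩
  | succ i ih =>
    obtain ⟨M, hM, S, hS, -, rfl⟩ := hL
    obtain ⟨A, rfl⟩ := exists_eq_deleteVertices_of_isPrunedTo hM
    have his : i ≤ s := by omega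
    have hvM := ih (by omega) hM
    have halive : ∀ z, G.Adj v z → ¬ Dies G s {v} z → z ∉ A := fun z hz hzd =>
      singleton_mem_deleteVertices_cliqueComplex.1 (alive_of_not_dies hM
        (fun h => hzd (h.mono his)) ((ht.of_root hz).mono (by omega)) hz.symm (by simp) hvM)
    rw [singleton_mem_deleteVertices_cliqueComplex] at hvM
    rw [deleteVertices_deleteVertices, singleton_mem_deleteVertices_cliqueComplex]
    rintro (hvA | hvS)
    · exact hvM hvA
    obtain ⟨a, hva, ha⟩ := exists_apex_of_isDominated (hS hvS)
    -- At least one of `w` and `y` differs from the apex `a`, and would form a triangle with `v` and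
    -- `a`.
    by_cases hwa : w = a
    · exact ht.not_adj_of_root hvy hva (ha y hvy (halive y hvy hy) (hwa ▸ hyw))
    · exact ht.not_adj_of_root hvw hva (ha w hvw (halive w hvw hw) hwa)

theorem mem_nonIsolated_cliqueComplex_iff {v : V} :
    v ∈ nonIsolated (cliqueComplex G) ↔ ¬ Dies G 1 ∅ v := by
  rw [← deleteVertices_empty (cliqueComplex G)]
  constructor
  · rintro ⟨-, w, hw, h⟩ hd
    exact hd w ((pair_mem_deleteVertices_cliqueComplex hw.symm).1 h).1 (by simp)
  · intro hd
    obtain ⟨w, hw⟩ : ∃ w, G.Adj v w := by simpa [Dies] using hd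
    exact ⟨singleton_mem_deleteVertices_cliqueComplex.2 (by simp), w, hw.ne',
      (pair_mem_deleteVertices_cliqueComplex hw.ne).2 ⟨hw, by simp⟩⟩

/-- Exactly one branch at `v` survives `s` rounds of leaf removal, and it survives a further
round. -/
def HasSingleBranch (G : SimpleGraph V) (s : ℕ) (v : V) : Prop :=
  ∃ w, G.Adj v w ∧ ¬ Dies G (s + 1) {v} w ∧ ∀ y, G.Adj v y → y ≠ w → Dies G s {v} y

/-- The last of the `s + 1` phases acts on a complex in which the branches that die within `s`
rounds are already cut off from `v`. Hence `v` needs one branch that survives all phases, to keep an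
edge, and a second one that survives `s` rounds, to avoid being a leaf in the last phase. -/
theorem mem_nonIsolated_iff {s : ℕ} {L : PreAbstractSimplicialComplex V} {v : V}
    (hL : IsPrunedTo (s + 1) (cliqueComplex G) L) (ht : TreeLike G (s + 3) ∅ v v) :
    v ∈ nonIsolated L ↔ ¬ Dies G (s + 2) ∅ v ∧ ¬ HasSingleBranch G s v := by
  have hL' := hL
  obtain ⟨M, hM, S, hS, hmax, rfl⟩ := hL
  obtain ⟨A, rfl⟩ := exists_eq_deleteVertices_of_isPrunedTo hM
  have htw : ∀ w, G.Adj v w → TreeLike G (s + 2) {v} v w := fun w hw => ht.of_root hw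
  constructor
  · rintro ⟨hv, w, hwv, hw⟩
    rw [deleteVertices_deleteVertices] at hv hw
    obtain ⟨hvw, hvA, hwA⟩ := (pair_mem_deleteVertices_cliqueComplex hwv.symm).1 hw
    refine ⟨fun hd => ?_, ?_⟩
    · refine not_both_alive_of_dies hL' (by simpa using hd w hvw (by simp)) (htw w hvw).of_succ
        hvw.symm ⟨?_, ?_⟩
      all_goals rwa [deleteVertices_deleteVertices, singleton_mem_deleteVertices_cliqueComplex]
    · rintro ⟨z, hvz, -, hz⟩
      have huniq : ∀ y, G.Adj v y → y ∉ A → y = z := fun y hy hyA => by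
        by_contra hyz
        refine not_both_alive_of_dies hM (hz y hy hyz) (htw y hy).of_succ.of_succ hy.symm ⟨?_, ?_⟩
        · rwa [singleton_mem_deleteVertices_cliqueComplex]
        · rw [singleton_mem_deleteVertices_cliqueComplex]
          exact fun h => hvA (Or.inl h)
      obtain rfl := huniq w hvw fun h => hwA (Or.inl h)
      exact not_both_survive_of_unique_neighbor hmax hvA hwA hvz huniq
  · rintro ⟨hd, hs⟩
    obtain ⟨w, hvw, hw⟩ : ∃ w, G.Adj v w ∧ ¬ Dies G (s + 1) {v} w := by
      by_contra! hcon
      exact hd fun w hw _ => by simpa using hcon w hw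
    obtain ⟨y, hvy, hyw, hy⟩ : ∃ y, G.Adj v y ∧ y ≠ w ∧ ¬ Dies G s {v} y := by
      by_contra! hcon
      exact hs ⟨w, hvw, hw, hcon⟩
    have hvL' := alive_of_two_branches le_rfl hL' ht hvw hvy hyw (fun h => hw h.succ) hy
    have hvL := hvL'
    rw [deleteVertices_deleteVertices, singleton_mem_deleteVertices_cliqueComplex] at hvL
    have hwL := alive_of_not_dies hL' hw (htw w hvw) hvw.symm (by simp) hvL'
    refine ⟨hvL', w, hvw.ne', ?_⟩
    rw [deleteVertices_deleteVertices] at hwL ⊢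
    rw [singleton_mem_deleteVertices_cliqueComplex] at hwL
    exact (pair_mem_deleteVertices_cliqueComplex hvw.ne).2 ⟨hvw, hvL, hwL⟩

end LocalStructure

/-! ### Expectations over the random graph and exposure of single edges -/

section Expectation

variable {V : Type*}

open Classical in
/-- The indicator of a proposition. -/
noncomputable def ind (P : Prop) : ℝ := if P then 1 else 0

theorem ind_of {P : Prop} (h : P) : ind P = 1 := if_pos h

theorem ind_of_not {P : Prop} (h : ¬ P) : ind P = 0 := if_neg h

theorem ind_nonneg (P : Prop) : 0 ≤ ind P := by
  by_cases h : P <;> simp [ind, h]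

theorem ind_le_one (P : Prop) : ind P ≤ 1 := by
  by_cases h : P <;> simp [ind, h]

theorem ind_not (P : Prop) : ind (¬ P) = 1 - ind P := by
  by_cases h : P <;> simp [ind, h]

theorem abs_ind_sub_ind (P Q : Prop) : |ind P - ind Q| = ind (¬ (P ↔ Q)) := by
  by_cases h : P <;> by_cases h' : Q <;> simp [ind, h, h']

theorem ind_le_add_sum {ι : Type*} {U : Finset ι} {P A : Prop} {B C : ι → Prop}
    (h : P → A ∨ ∃ w ∈ U, B w ∧ C w) : ind P ≤ ind A + ∑ w ∈ U, ind (B w) * ind (C w) := by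
  have hnn : ∀ w ∈ U, 0 ≤ ind (B w) * ind (C w) := fun w _ =>
    mul_nonneg (ind_nonneg _) (ind_nonneg _)
  by_cases hP : P
  · obtain hA | ⟨w, hw, hB, hC⟩ := h hP
    · rw [ind_of hA]
      linarith [ind_le_one P, Finset.sum_nonneg hnn]
    · have := Finset.single_le_sum hnn hw
      rw [ind_of hB, ind_of hC] at this
      linarith [ind_le_one P, ind_nonneg A]
  · rw [ind_of_not hP]
    exact add_nonneg (ind_nonneg _) (Finset.sum_nonneg hnn)

/-- `f` takes the same value on graphs that differ at most in the edge `vw`. -/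
def IgnoresEdge {α : Type*} (v w : V) (f : SimpleGraph V → α) : Prop :=
  ∀ G H : SimpleGraph V, (∀ a b, s(a, b) ≠ s(v, w) → (G.Adj a b ↔ H.Adj a b)) → f G = f H

theorem IgnoresEdge.comp {α β : Type*} {v w : V} {f : SimpleGraph V → α} (h : IgnoresEdge v w f)
    (g : α → β) : IgnoresEdge v w fun G => g (f G) :=
  fun G H hGH => congrArg g (h G H hGH)

theorem IgnoresEdge.comp₂ {α β γ : Type*} {v w : V} {f : SimpleGraph V → α}
    {f' : SimpleGraph V → β} (h : IgnoresEdge v w f) (h' : IgnoresEdge v w f') (g : α → β → γ) :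
    IgnoresEdge v w fun G => g (f G) (f' G) :=
  fun G H hGH => congrArg₂ g (h G H hGH) (h' G H hGH)

theorem ignoresEdge_const {α : Type*} {v w : V} (a : α) :
    IgnoresEdge v w fun _ => a := fun _ _ _ => rfl

theorem ignoresEdge_adj {v w a b : V} (h : s(a, b) ≠ s(v, w)) :
    IgnoresEdge v w fun G : SimpleGraph V => G.Adj a b :=
  fun _ _ hGH => propext (hGH a b h)

theorem ignoresEdge_prod {ι : Type*} {v w : V} {U : Finset ι} {f : ι → SimpleGraph V → ℝ}
    (h : ∀ i ∈ U, IgnoresEdge v w (f i)) : IgnoresEdge v w fun G => ∏ i ∈ U, f i G :=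
  fun G H hGH => Finset.prod_congr rfl fun i hi => h i hi G H hGH

theorem real_binomialRandom_singleton [Finite V] {p : unitInterval} (G : SimpleGraph V) :
    (SimpleGraph.binomialRandom V p).real {G} =
      (p : ℝ) ^ G.edgeSet.ncard * (1 - p : ℝ) ^ ((Nat.card V).choose 2 - G.edgeSet.ncard) := by
  simp [measureReal_def]

instance [Countable V] : MeasurableSingletonClass (SimpleGraph V) where
  measurableSet_singleton G := by
    have := SimpleGraph.measurable_edgeSet (measurableSet_singleton G.edgeSet)
    convert this
    ext H
    simp

variable [Fintype V] [DecidableEq V]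

/-- The expectation of `f` for the binomial random graph, as a finite sum. -/
noncomputable def expect (p : unitInterval) (f : SimpleGraph V → ℝ) : ℝ :=
  ∑ G, (SimpleGraph.binomialRandom V p).real {G} * f G

theorem integral_binomialRandom (p : unitInterval) (f : SimpleGraph V → ℝ) :
    ∫ G, f G ∂(SimpleGraph.binomialRandom V p) = expect p f := by
  rw [integral_fintype .of_finite]
  rfl

variable {p : unitInterval}

theorem expect_add (f g : SimpleGraph V → ℝ) :
    expect p (fun G => f G + g G) = expect p f + expect p g := by
  simp only [expect, mul_add, Finset.sum_add_distrib]

theorem expect_sub (f g : SimpleGraph V → ℝ) :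
    expect p (fun G => f G - g G) = expect p f - expect p g := by
  simp only [expect, mul_sub, Finset.sum_sub_distrib]

theorem expect_const_mul (a : ℝ) (f : SimpleGraph V → ℝ) :
    expect p (fun G => a * f G) = a * expect p f := by
  simp only [expect, Finset.mul_sum]
  exact Finset.sum_congr rfl fun _ _ => by ring

theorem expect_sum {ι : Type*} (U : Finset ι) (f : ι → SimpleGraph V → ℝ) :
    expect p (fun G => ∑ i ∈ U, f i G) = ∑ i ∈ U, expect p (f i) := by
  simp only [expect, Finset.mul_sum]
  exact Finset.sum_comm

theorem expect_mono {f g : SimpleGraph V → ℝ} (h : ∀ G, f G ≤ g G) : expect p f ≤ expect p g :=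
  Finset.sum_le_sum fun G _ => mul_le_mul_of_nonneg_left (h G) measureReal_nonneg

theorem expect_const (a : ℝ) : expect p (fun _ : SimpleGraph V => a) = a := by
  rw [← integral_binomialRandom]
  simp

theorem abs_expect_le (f : SimpleGraph V → ℝ) : |expect p f| ≤ expect p fun G => |f G| := by
  rw [abs_le]
  constructor
  · rw [neg_le_iff_add_nonneg, ← expect_add, ← expect_const (V := V) (p := p) 0]
    exact expect_mono fun G => by linarith [neg_abs_le (f G)]
  · exact expect_mono fun G => le_abs_self _

theorem abs_expect_sub_le (f g : SimpleGraph V → ℝ) :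
    |expect p f - expect p g| ≤ expect p fun G => |f G - g G| := by
  rw [← expect_sub]
  exact abs_expect_le _

theorem abs_expect_sub_const_le (f : SimpleGraph V → ℝ) (a : ℝ) :
    |expect p f - a| ≤ expect p fun G => |f G - a| := by
  conv_lhs => rw [← expect_const (V := V) (p := p) a]
  exact abs_expect_sub_le _ _

/-- Adding a missing edge changes the weight by the factor `p / (1 - p)`. -/
theorem real_binomialRandom_sup_edge {G : SimpleGraph V} {v w : V} (hvw : v ≠ w)
    (h : ¬ G.Adj v w) :
    (1 - p : ℝ) * (SimpleGraph.binomialRandom V p).real {G ⊔ SimpleGraph.edge v w} =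
      p * (SimpleGraph.binomialRandom V p).real {G} := by
  have hcard : (G ⊔ SimpleGraph.edge v w).edgeSet.ncard = G.edgeSet.ncard + 1 := by
    rw [SimpleGraph.edgeSet_sup, SimpleGraph.edgeSet_edge_of_ne hvw, Set.union_singleton]
    exact Set.ncard_insert_of_notMem h
  have hle : (G ⊔ SimpleGraph.edge v w).edgeSet.ncard ≤ (Nat.card V).choose 2 := by
    classical
    rw [Nat.card_eq_fintype_card, ← SimpleGraph.coe_edgeFinset, Set.ncard_coe_finset]
    exact SimpleGraph.card_edgeFinset_le_card_choose_two
  rw [real_binomialRandom_singleton, real_binomialRandom_singleton, hcard]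
  rw [hcard] at hle
  obtain ⟨m, hm⟩ := Nat.exists_eq_add_of_le hle
  rw [show (Nat.card V).choose 2 - G.edgeSet.ncard = m + 1 by omega,
    show (Nat.card V).choose 2 - (G.edgeSet.ncard + 1) = m by omega]
  ring

/-- A single edge is present with probability `p`, independently of everything that ignores it. -/
theorem expect_adj_mul {v w : V} (hvw : v ≠ w) {f : SimpleGraph V → ℝ} (hf : IgnoresEdge v w f) :
    expect p (fun G => ind (G.Adj v w) * f G) = p * expect p f := by
  classical
  set μ := fun G : SimpleGraph V => (SimpleGraph.binomialRandom V p).real {G} with hμ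
  have h1 : expect p (fun G => ind (G.Adj v w) * f G) = ∑ G with G.Adj v w, μ G * f G := by
    rw [expect, Finset.sum_filter]
    refine Finset.sum_congr rfl fun G _ => ?_
    split_ifs with h
    · rw [ind_of h, one_mul]
    · rw [ind_of_not h, zero_mul, mul_zero]
  have h2 : expect p f = ∑ G with G.Adj v w, μ G * f G + ∑ G with ¬ G.Adj v w, μ G * f G :=
    (Finset.sum_filter_add_sum_filter_not _ _ _).symm
  have h3 : (1 - p : ℝ) * ∑ G with G.Adj v w, μ G * f G =
      p * ∑ G with ¬ G.Adj v w, μ G * f G := by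
    rw [Finset.mul_sum, Finset.mul_sum]
    symm
    -- Adding and deleting `vw` match the graphs without this edge to those with it; `f` does not
    -- change and the weight changes by `p / (1 - p)`.
    refine Finset.sum_bij' (fun G _ => G ⊔ SimpleGraph.edge v w)
      (fun G _ => G.deleteEdges {s(v, w)}) ?_ ?_ ?_ ?_ ?_
    · intro G _
      simp [SimpleGraph.edge_adj, hvw]
    · intro G _
      simp
    · intro G hG
      have hG' : ¬ G.Adj v w := by simpa using hG
      ext a b
      simp only [SimpleGraph.deleteEdges_adj, SimpleGraph.sup_adj, SimpleGraph.edge_adj,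
        Set.mem_singleton_iff, Sym2.eq_iff]
      constructor
      · tauto
      · intro hab
        refine ⟨Or.inl hab, ?_⟩
        rintro (⟨rfl, rfl⟩ | ⟨rfl, rfl⟩)
        · exact hG' hab
        · exact hG' hab.symm
    · intro G hG
      have hG' : G.Adj v w := by simpa using hG
      ext a b
      simp only [SimpleGraph.deleteEdges_adj, SimpleGraph.sup_adj, SimpleGraph.edge_adj,
        Set.mem_singleton_iff, Sym2.eq_iff]
      constructor
      · rintro (h | ⟨⟨rfl, rfl⟩ | ⟨rfl, rfl⟩, -⟩)
        · exact h.1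
        · exact hG'
        · exact hG'.symm
      · intro hab
        have := hab.ne
        tauto
    · intro G hG
      have hG' : ¬ G.Adj v w := by simpa using hG
      have hfG : f (G ⊔ SimpleGraph.edge v w) = f G := by
        refine hf _ _ fun a b hab => ?_
        rw [SimpleGraph.sup_adj, SimpleGraph.edge_adj]
        rw [ne_eq, Sym2.eq_iff] at hab
        tauto
      rw [hfG, ← mul_assoc, ← mul_assoc, hμ, real_binomialRandom_sup_edge hvw hG']
  rw [h1, h2]
  linarith

/-- The edges at `v` are independent of everything that ignores them. -/
theorem expect_prod_one_sub_adj {v : V} {U : Finset V} (hvU : v ∉ U)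
    {a : V → SimpleGraph V → ℝ} {f : SimpleGraph V → ℝ}
    (ha : ∀ y ∈ U, ∀ w ∈ U, IgnoresEdge v w (a y)) (hf : ∀ w ∈ U, IgnoresEdge v w f) :
    expect p (fun G => (∏ y ∈ U, (1 - a y G * ind (G.Adj v y))) * f G) =
      expect p fun G => (∏ y ∈ U, (1 - p * a y G)) * f G := by
  induction U using Finset.induction_on generalizing f with
  | empty => simp
  | insert w U hw ih =>
    have hvw : v ≠ w := fun h => hvU (h ▸ Finset.mem_insert_self w U)
    have hvU' : v ∉ U := fun h => hvU (Finset.mem_insert_of_mem h)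
    have hmem : ∀ {y}, y ∈ U → y ∈ insert w U := Finset.mem_insert_of_mem
    have hign : IgnoresEdge v w fun G =>
        a w G * ((∏ y ∈ U, (1 - a y G * ind (G.Adj v y))) * f G) := by
      refine (ha w (by simp) w (by simp)).comp₂ (IgnoresEdge.comp₂ (ignoresEdge_prod fun y hy => ?_)
        (hf w (by simp)) (· * ·)) (· * ·)
      refine (ha y (hmem hy) w (by simp)).comp₂ (ignoresEdge_adj ?_) (fun x y => 1 - x * ind y)
      rw [ne_eq, Sym2.eq_iff]
      rintro (⟨-, rfl⟩ | ⟨h, -⟩)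
      · exact hw hy
      · exact hvw h
    have key := expect_adj_mul (p := p) hvw hign
    calc expect p (fun G => (∏ y ∈ insert w U, (1 - a y G * ind (G.Adj v y))) * f G)
        = expect p (fun G => (∏ y ∈ U, (1 - a y G * ind (G.Adj v y))) * f G -
            ind (G.Adj v w) *
              (a w G * ((∏ y ∈ U, (1 - a y G * ind (G.Adj v y))) * f G))) := by
          congr 1
          ext G
          rw [Finset.prod_insert hw]
          ring
      _ = expect p (fun G => (∏ y ∈ U, (1 - a y G * ind (G.Adj v y))) *
            ((1 - p * a w G) * f G)) := by
          rw [expect_sub, key, ← expect_const_mul, ← expect_sub]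
          congr 1
          ext G
          ring
      -- The factor of the edge `vw`, already averaged, ignores the other edges at `v`, so it joins
      -- `f` in the induction hypothesis.
      _ = expect p (fun G => (∏ y ∈ U, (1 - p * a y G)) * ((1 - p * a w G) * f G)) := by
          refine ih hvU' (fun y hy z hz => ha y (hmem hy) z (hmem hz)) fun z hz => ?_
          exact (ha w (by simp) z (hmem hz)).comp₂ (hf z (hmem hz)) (fun x y => (1 - p * x) * y)
      _ = _ := by
          congr 1
          ext G
          rw [Finset.prod_insert hw]
          ring

-- Averaging over the edges at `v`, each vertex that violates `Q` must be a non-neighbour of `v`,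
-- which contributes one factor `1 - p`.
open Classical in
theorem expect_forall_adj_mul {v : V} {U : Finset V} (hvU : v ∉ U)
    {Q : V → SimpleGraph V → Prop} {f : SimpleGraph V → ℝ}
    (hQ : ∀ y ∈ U, ∀ w ∈ U, IgnoresEdge v w (Q y)) (hf : ∀ w ∈ U, IgnoresEdge v w f) :
    expect p (fun G => ind (∀ y ∈ U, G.Adj v y → Q y G) * f G) =
      expect p fun G => (1 - p : ℝ) ^ (U.filter fun y => ¬ Q y G).card * f G := by
  have key := expect_prod_one_sub_adj (p := p) hvU (a := fun y G => ind (¬ Q y G)) (f := f)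
    (fun y hy w hw => (hQ y hy w hw).comp fun P => ind (¬ P)) hf
  convert key using 3 with G G
  · congr 1
    by_cases h : ∀ y ∈ U, G.Adj v y → Q y G
    · rw [ind_of h, Finset.prod_eq_one]
      intro y hy
      by_cases hy' : G.Adj v y
      · simp [ind, h y hy hy']
      · simp [ind, hy']
    · rw [ind_of_not h]
      push Not at h
      obtain ⟨y, hy, hadj, hQy⟩ := h
      rw [Finset.prod_eq_zero hy]
      simp [ind, hadj, hQy]
  · congr 1
    rw [Finset.card_filter, ← Finset.prod_pow_eq_pow_sum]
    refine Finset.prod_congr rfl fun y _ => ?_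
    by_cases h : Q y G <;> simp [ind, h]

end Expectation

/-! ### Exploring the branch of a vertex -/

section Exploration

variable {V : Type*}

theorem sum_mul_le_of_card_mul_le [Fintype V] {p : unitInterval} {c b : ℝ} (hc : Fintype.card V * (p : ℝ) ≤ c) (hb : 0 ≤ b)
    (U : Finset V) {f : V → ℝ} (hf : ∀ w ∈ U, f w ≤ p * b) : ∑ w ∈ U, f w ≤ c * b :=
  calc ∑ w ∈ U, f w ≤ U.card • (p * b) := Finset.sum_le_card_nsmul _ _ _ hf
    _ = U.card * p * b := by rw [nsmul_eq_mul]; ring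
    _ ≤ Fintype.card V * p * b := by
        gcongr
        · exact p.2.1
        · exact Finset.card_le_univ U
    _ ≤ c * b := by gcongr

variable [DecidableEq V]

theorem Dies.congr {G H : SimpleGraph V} {s : ℕ} {X : Finset V} {u : V} (hu : u ∉ X)
    (h : ∀ a b, a ∉ X → b ∉ X → (G.Adj a b ↔ H.Adj a b)) : Dies G s X u ↔ Dies H s X u := by
  induction s generalizing X u with
  | zero => rfl
  | succ s ih =>
    refine forall_congr' fun w => ?_
    by_cases hw : w ∈ X
    · simp [hw]
    · rw [h u w hu hw]
      refine imp_congr_right fun hadj => imp_congr_right fun _ => ih ?_ fun a b ha hb => ?_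
      · simp [hw, hadj.ne']
      · exact h a b (fun h => ha (by simp [h])) (fun h => hb (by simp [h]))

/-- The exploration from `u` never inspects an edge that meets `X`; this is the source of all
independence used below. -/
theorem ignoresEdge_dies {s : ℕ} {X : Finset V} {u v w : V} (hu : u ∉ X) (hv : v ∈ X) :
    IgnoresEdge v w fun G : SimpleGraph V => Dies G s X u := fun G H h =>
  propext (Dies.congr hu fun a b ha hb => h a b fun e => by
    rw [Sym2.eq_iff] at e
    obtain ⟨rfl, -⟩ | ⟨-, rfl⟩ := e
    · exact ha hv
    · exact hb hv)

theorem TreeLike.congr {G H : SimpleGraph V} {s : ℕ} {X : Finset V} {x u : V} (hu : u ∉ X)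
    (h : ∀ a b, a ∉ X → (G.Adj a b ↔ H.Adj a b)) : TreeLike G s X x u ↔ TreeLike H s X x u := by
  induction s generalizing X x u with
  | zero => rfl
  | succ s ih =>
    refine and_congr (by simp only [h u _ hu]) (forall_congr' fun w => ?_)
    rw [h u w hu]
    refine imp_congr_right fun hadj => imp_congr_right fun hw => ih ?_ fun a b ha => ?_
    · simp [hw, hadj.ne']
    · exact h a b fun h => ha (by simp [h])

/-- The chord test at `u` exempts `x`, and later tests start outside `insert u X`, so the edge by
which `u` was reached is never examined. -/
theorem ignoresEdge_treeLike {s : ℕ} {X : Finset V} {x u : V} (hu : u ∉ X) (hx : x ∈ X) :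
    IgnoresEdge x u fun G : SimpleGraph V => TreeLike G s X x u := by
  intro G H h
  cases s with
  | zero => rfl
  | succ s =>
    have hxu : x ≠ u := fun e => hu (e ▸ hx)
    refine propext (and_congr (forall₂_congr fun y hy => ?_) (forall_congr' fun w => ?_))
    · by_cases hyx : y = x
      · simp [hyx]
      · rw [h u y]
        rw [ne_eq, Sym2.eq_iff]
        rintro (⟨e, -⟩ | ⟨-, e⟩)
        · exact hxu e.symm
        · exact hyx e
    · by_cases hw : w ∈ X
      · simp [hw]
      · have : s(u, w) ≠ s(x, u) := by
          rw [ne_eq, Sym2.eq_iff]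
          rintro (⟨e, -⟩ | ⟨-, e⟩)
          · exact hxu e.symm
          · exact hw (e ▸ hx)
        rw [h u w this]
        refine imp_congr_right fun hadj => imp_congr_right fun _ =>
          TreeLike.congr (by simp [hw, hadj.ne']) fun a b ha => h a b fun e => ?_
        rw [Sym2.eq_iff] at e
        obtain ⟨rfl, -⟩ | ⟨rfl, -⟩ := e
        · exact ha (Finset.mem_insert_of_mem hx)
        · exact ha (Finset.mem_insert_self _ _)

variable [Fintype V]

open Classical in
/-- The number of vertices whose branches survive `s` rounds of leaf removal once `X` has been
deleted. -/
noncomputable def survivors (G : SimpleGraph V) (s : ℕ) (X : Finset V) : ℕ :=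
  (Xᶜ.filter fun w => ¬ Dies G s X w).card

theorem survivors_eq_sum (G : SimpleGraph V) (s : ℕ) (X : Finset V) :
    (survivors G s X : ℝ) = ∑ w ∈ Xᶜ, ind (¬ Dies G s X w) := by
  rw [survivors, Finset.card_filter]
  push_cast
  exact Finset.sum_congr rfl fun _ _ => by simp [ind]

theorem survivors_le (G : SimpleGraph V) (s : ℕ) (X : Finset V) :
    survivors G s X ≤ Fintype.card V :=
  Finset.card_le_univ _

variable {p : unitInterval}

/-- The counterpart of the Galton–Watson recursion: `u` dies iff it is adjacent to none of the
surviving vertices, and these are determined without the edges at `u`. -/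
theorem expect_dies_succ_mul {s : ℕ} {X : Finset V} {u : V} {f : SimpleGraph V → ℝ}
    (hf : ∀ w, w ∉ insert u X → IgnoresEdge u w f) :
    expect p (fun G => ind (Dies G (s + 1) X u) * f G) =
      expect p fun G => (1 - p : ℝ) ^ survivors G s (insert u X) * f G := by
  have key := expect_forall_adj_mul (p := p) (v := u) (U := (insert u X)ᶜ) (by simp)
    (Q := fun y G => Dies G s (insert u X) y) (f := f)
    (fun y hy w _ => ignoresEdge_dies (Finset.mem_compl.1 hy) (Finset.mem_insert_self u X))
    (fun w hw => hf w (Finset.mem_compl.1 hw))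
  convert key using 5 with G
  · constructor
    · exact fun h y hy hadj => h y hadj fun hX => by simp [hX] at hy
    · exact fun h y hadj hX => h y (by simp [hX, hadj.ne']) hadj
  · rfl

theorem expect_dies_succ {s : ℕ} {X : Finset V} {u : V} :
    expect p (fun G => ind (Dies G (s + 1) X u)) =
      expect p fun G => (1 - p : ℝ) ^ survivors G s (insert u X) := by
  simpa using expect_dies_succ_mul (p := p) (s := s) (X := X) (u := u) (f := fun _ => 1)
    fun _ _ => ignoresEdge_const _

theorem expect_adj_mul_le {v w : V} (hvw : v ≠ w) {f : SimpleGraph V → ℝ}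
    (hf : IgnoresEdge v w f) {b : ℝ} (hb : expect p f ≤ b) :
    expect p (fun G => ind (G.Adj v w) * f G) ≤ p * b := by
  rw [expect_adj_mul hvw hf]
  exact mul_le_mul_of_nonneg_left hb p.2.1

theorem expect_adj {v w : V} (hvw : v ≠ w) :
    expect p (fun G => ind (G.Adj v w)) = p := by
  simpa [expect_const] using expect_adj_mul (p := p) hvw (ignoresEdge_const (1 : ℝ))

/-- Deleting one further vertex hardly affects the branch at `u`. -/
theorem expect_dies_insert_ne_le {c : ℝ} (hc : Fintype.card V * (p : ℝ) ≤ c) (hc0 : 0 ≤ c)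
    (s : ℕ) {X : Finset V} {u y : V} (hu : u ∉ X) (huy : u ≠ y) :
    expect p (fun G => ind (¬ (Dies G s X u ↔ Dies G s (insert y X) u))) ≤ (1 + c) ^ s * p := by
  induction s generalizing X u with
  | zero =>
    simp only [Dies, not_true, pow_zero, one_mul]
    rw [ind_of_not not_false, expect_const]
    exact p.2.1
  | succ s ih =>
    have hb : 0 ≤ (1 + c) ^ s * (p : ℝ) := mul_nonneg (by positivity) p.2.1
    calc expect p (fun G => ind (¬ (Dies G (s + 1) X u ↔ Dies G (s + 1) (insert y X) u)))
        ≤ expect p (fun G => ind (G.Adj u y) + ∑ w ∈ (insert y (insert u X))ᶜ, ind (G.Adj u w) *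
            ind (¬ (Dies G s (insert u X) w ↔ Dies G s (insert y (insert u X)) w))) := by
          -- The events can differ only if `u` is adjacent to `y`, or if deleting `y` matters for
          -- the branch at some neighbour of `u`.
          refine expect_mono fun G => ind_le_add_sum fun h => ?_
          by_contra! hcon
          refine h (forall_congr' fun w => imp_congr_right fun hw => ?_)
          have hwy : w ≠ y := fun e => hcon.1 (e ▸ hw)
          by_cases hwX : w ∈ X
          · simp [hwX]
          · rw [Finset.insert_comm u y]
            simp [hwX, hwy, hcon.2 w (by simp [hwX, hwy, hw.ne']) hw]
      _ ≤ p + c * ((1 + c) ^ s * p) := by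
          rw [expect_add, expect_adj huy, expect_sum]
          gcongr
          refine sum_mul_le_of_card_mul_le hc hb _ fun w hw => ?_
          rw [Finset.mem_compl] at hw
          have hwX : w ∉ insert u X := fun h => hw (Finset.mem_insert_of_mem h)
          refine expect_adj_mul_le (fun e => hwX (by simp [e])) ?_ (ih hwX fun e => hw (by simp [e]))
          exact (ignoresEdge_dies hwX (by simp)).comp₂ (ignoresEdge_dies hw (by simp))
            fun P Q => ind (¬ (P ↔ Q))
      _ ≤ (1 + c) ^ (s + 1) * p := by
          have h1 : (1 : ℝ) ≤ (1 + c) ^ s := one_le_pow₀ (by linarith)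
          have h2 : (p : ℝ) ≤ (1 + c) ^ s * p := le_mul_of_one_le_left p.2.1 h1
          rw [pow_succ]
          linarith

/-- Union bound: a chord from `u` to `X` costs at most `X.card * p`, and passing to the neighbours
multiplies by at most `c` and enlarges `X` by one vertex. -/
theorem expect_not_treeLike_le {c : ℝ} (hc : Fintype.card V * (p : ℝ) ≤ c) (hc0 : 0 ≤ c)
    (s : ℕ) {X : Finset V} {x u : V} (hu : u ∉ X) :
    expect p (fun G => ind (¬ TreeLike G s X x u)) ≤ (X.card + s) * (1 + c) ^ s * p := by
  induction s generalizing X x u with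
  | zero =>
    simp only [TreeLike, not_true]
    rw [ind_of_not not_false, expect_const]
    exact mul_nonneg (by positivity) p.2.1
  | succ s ih =>
    have hp := p.2.1
    have hb : 0 ≤ ((insert u X).card + s) * (1 + c) ^ s * (p : ℝ) :=
      mul_nonneg (by positivity) p.2.1
    calc expect p (fun G => ind (¬ TreeLike G (s + 1) X x u))
        ≤ expect p (fun G => ∑ y ∈ X, ind (G.Adj u y) + ∑ w ∈ (insert u X)ᶜ, ind (G.Adj u w) *
            ind (¬ TreeLike G s (insert u X) u w)) := by
          refine expect_mono fun G => (ind_le_add_sum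
            (A := ∃ y ∈ X, G.Adj u y) (U := (insert u X)ᶜ) (B := fun w => G.Adj u w)
            (C := fun w => ¬ TreeLike G s (insert u X) u w) fun h => ?_).trans ?_
          · by_contra! hcon
            refine h ⟨fun y hy hadj => absurd hadj (hcon.1 y hy), fun w hw hwX => ?_⟩
            exact hcon.2 w (by simp [hwX, hw.ne']) hw
          · gcongr
            have := ind_le_add_sum (U := X) (P := ∃ y ∈ X, G.Adj u y) (A := False)
              (B := fun y => G.Adj u y) (C := fun _ => True) (by simp)
            simpa [ind_of_not not_false, ind_of trivial] using this
      _ ≤ X.card * p + c * (((insert u X).card + s) * (1 + c) ^ s * p) := by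
          rw [expect_add, expect_sum, expect_sum]
          gcongr
          · rw [← nsmul_eq_mul]
            refine Finset.sum_le_card_nsmul _ _ _ fun y hy => ?_
            exact (expect_adj (ne_of_mem_of_not_mem hy hu).symm).le
          · refine sum_mul_le_of_card_mul_le hc hb _ fun w hw => ?_
            rw [Finset.mem_compl] at hw
            exact expect_adj_mul_le (fun e => hw (by simp [e]))
              ((ignoresEdge_treeLike hw (by simp)).comp fun P => ind (¬ P)) (ih hw)
      _ ≤ (X.card + (s + 1 : ℕ)) * (1 + c) ^ (s + 1) * p := by
          have h1 : (1 : ℝ) ≤ (1 + c) ^ s := one_le_pow₀ (by linarith)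
          have h2 : (X.card : ℝ) * p ≤ (X.card + s + 1) * (1 + c) ^ s * p := by
            gcongr
            nlinarith [X.card.cast_nonneg (α := ℝ), s.cast_nonneg (α := ℝ)]
          rw [Finset.card_insert_of_notMem hu, pow_succ]
          push_cast
          linarith

end Exploration

/-! ### Concentration of the number of surviving branches -/

section Concentration

theorem abs_exp_neg_sub_exp_neg_le {x y : ℝ} (hx : 0 ≤ x) (hy : 0 ≤ y) :
    |Real.exp (-x) - Real.exp (-y)| ≤ |x - y| := by
  wlog h : x ≤ y generalizing x y
  · rw [abs_sub_comm, abs_sub_comm x]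
    exact this hy hx (le_of_not_ge h)
  have h1 : Real.exp (-y) ≤ Real.exp (-x) := Real.exp_le_exp.2 (by linarith)
  rw [abs_of_nonneg (by linarith), abs_of_nonpos (by linarith)]
  have h2 : Real.exp (-y) = Real.exp (-x) * Real.exp (x - y) := by
    rw [← Real.exp_add]
    congr 1
    ring
  have h3 : Real.exp (-x) ≤ 1 := Real.exp_le_one_iff.2 (by linarith)
  nlinarith [Real.add_one_le_exp (x - y), Real.exp_pos (-x)]

theorem abs_pow_sub_pow_le_of_mem_unit {a b : ℝ} (ha : 0 ≤ a) (ha' : a ≤ 1) (hb : 0 ≤ b)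
    (hb' : b ≤ 1) (z : ℕ) : |a ^ z - b ^ z| ≤ z * |a - b| := by
  induction z with
  | zero => simp
  | succ z ih =>
    have h : a ^ (z + 1) - b ^ (z + 1) = a * (a ^ z - b ^ z) + (a - b) * b ^ z := by ring
    rw [h]
    refine (abs_add_le _ _).trans ?_
    rw [abs_mul, abs_mul, abs_of_nonneg ha, abs_of_nonneg (pow_nonneg hb z)]
    have h1 : a * |a ^ z - b ^ z| ≤ |a ^ z - b ^ z| := mul_le_of_le_one_left (abs_nonneg _) ha'
    have h2 : |a - b| * b ^ z ≤ |a - b| :=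
      mul_le_of_le_one_right (abs_nonneg _) (pow_le_one₀ hb hb')
    push_cast
    linarith

theorem abs_one_sub_sub_exp_neg_le {p : ℝ} (hp : 0 ≤ p) (hp' : p ≤ 1) :
    |1 - p - Real.exp (-p)| ≤ p ^ 2 := by
  have := Real.abs_exp_sub_one_sub_id_le (x := -p) (by rwa [abs_neg, abs_of_nonneg hp])
  rw [abs_sub_comm]
  convert this using 1
  · congr 1
    ring
  · ring

/-- The comparison goes through `exp (-c/n) ^ z`: the first error is at most `n (c/n)²`, and the
second is the Lipschitz bound for `exp (-x)` on `x ≥ 0`. -/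
theorem abs_one_sub_div_pow_sub_exp_le {c ζ : ℝ} {n z : ℕ} (hn : 0 < n) (hc : 0 ≤ c)
    (hcn : c ≤ n) (hz : z ≤ n) (hζ : 0 ≤ ζ) :
    |(1 - c / n) ^ z - Real.exp (-c * ζ)| ≤ c * |z / n - ζ| + c ^ 2 / n := by
  have hn' : (0 : ℝ) < n := by exact_mod_cast hn
  have hp : 0 ≤ c / n := by positivity
  have hp' : c / n ≤ 1 := (div_le_one hn').2 hcn
  have h1 : |(1 - c / n) ^ z - Real.exp (-(c / n)) ^ z| ≤ c ^ 2 / n := by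
    refine (abs_pow_sub_pow_le_of_mem_unit (by linarith) (by linarith) (Real.exp_pos _).le
      (Real.exp_le_one_iff.2 (by linarith)) z).trans ?_
    calc (z : ℝ) * |1 - c / n - Real.exp (-(c / n))| ≤ n * (c / n) ^ 2 := by
          gcongr
          exact abs_one_sub_sub_exp_neg_le hp hp'
      _ = c ^ 2 / n := by field_simp
  have h2 : |Real.exp (-(c / n)) ^ z - Real.exp (-c * ζ)| ≤ c * |z / n - ζ| := by
    rw [← Real.exp_nat_mul, show (z : ℝ) * -(c / n) = -(c * (z / n)) by ring,
      show -c * ζ = -(c * ζ) by ring]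
    refine (abs_exp_neg_sub_exp_neg_le (by positivity) (by positivity)).trans ?_
    rw [← mul_sub, abs_mul, abs_of_nonneg hc]
  linarith [abs_sub_le ((1 - c / n) ^ z) (Real.exp (-(c / n)) ^ z) (Real.exp (-c * ζ))]

theorem coe_edgeProb {c : ℝ≥0} {n : ℕ} (hcn : (c : ℝ) ≤ n) : (edgeProb c n : ℝ) = c / n := by
  rw [edgeProb, Set.projIcc_of_mem]
  exact ⟨by positivity, div_le_one_of_le₀ hcn (by positivity)⟩

theorem ignoresEdge_survivors {V : Type*} [Fintype V] [DecidableEq V] {s : ℕ} {X : Finset V}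
    {v w : V} (hv : v ∈ X) : IgnoresEdge v w fun G : SimpleGraph V => survivors G s X := by
  intro G H h
  have : (survivors G s X : ℝ) = survivors H s X := by
    rw [survivors_eq_sum, survivors_eq_sum]
    refine Finset.sum_congr rfl fun u hu => ?_
    exact (ignoresEdge_dies (Finset.mem_compl.1 hu) hv).comp (fun P => ind (¬ P)) G H h
  exact_mod_cast this

variable {c : ℝ≥0} {n : ℕ}

theorem expect_pow_survivors_sub_le (hn : 0 < n) (hcn : (c : ℝ) ≤ n) {s : ℕ} {X : Finset (Fin n)}
    {δ : ℝ} (h : expect (edgeProb c n)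
      (fun G => |(survivors G s X : ℝ) / n - (1 - gamma c s)|) ≤ δ) :
    expect (edgeProb c n)
      (fun G => |(1 - edgeProb c n : ℝ) ^ survivors G s X - gamma c (s + 1)|) ≤
        c * δ + c ^ 2 / n := by
  calc _ ≤ expect (edgeProb c n) (fun G =>
        c * |(survivors G s X : ℝ) / n - (1 - gamma c s)| + (c : ℝ) ^ 2 / n) := by
        refine expect_mono fun G => ?_
        rw [coe_edgeProb hcn, gamma_succ]
        refine abs_one_sub_div_pow_sub_exp_le hn c.2 hcn ?_ (by linarith [gamma_le_one c s])
        simpa using survivors_le G s X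
    _ ≤ _ := by
        rw [expect_add, expect_const_mul, expect_const]
        gcongr

section Pairs

variable {V : Type*} [Fintype V] [DecidableEq V] {p : unitInterval}

/-- With each vertex deleted from the exploration of the other, both read the same graph, without
`u`, `w` and `X`. Exposing the edges at `u` and then those at `w` turns both indicators into the
same power of `1 - p`, hence the square. -/
theorem expect_pair_eq {s : ℕ} {X : Finset V} {u w : V} (hw : w ∉ X) (huw : u ≠ w) (g : ℝ) :
    expect p (fun G => (ind (Dies G (s + 1) (insert w X) u) - g) *
        (ind (Dies G (s + 1) (insert u X) w) - g)) =
      expect p fun G => ((1 - p : ℝ) ^ survivors G s (insert u (insert w X)) - g) ^ 2 := by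
  have hw' : w ∉ insert u X := by simp [hw, huw.symm]
  have h1 := expect_dies_succ_mul (p := p) (s := s) (X := insert w X) (u := u)
    (f := fun G => ind (Dies G (s + 1) (insert u X) w) - g)
    (fun z _ => (ignoresEdge_dies hw' (by simp)).comp fun P => ind P - g)
  have h2 := expect_dies_succ_mul (p := p) (s := s) (X := insert u X) (u := w)
    (f := fun G => (1 - p : ℝ) ^ survivors G s (insert u (insert w X)) - g)
    (fun z _ => (ignoresEdge_survivors (by simp)).comp fun k => (1 - p : ℝ) ^ k - g)
  rw [Finset.insert_comm w u] at h2
  calc _ = expect p (fun G => ind (Dies G (s + 1) (insert w X) u) *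
            (ind (Dies G (s + 1) (insert u X) w) - g)) -
          g * expect p (fun G => ind (Dies G (s + 1) (insert u X) w) - g) := by
        rw [← expect_const_mul, ← expect_sub]
        congr 1
        ext G
        ring
    _ = expect p (fun G => ind (Dies G (s + 1) (insert u X) w) *
            ((1 - p : ℝ) ^ survivors G s (insert u (insert w X)) - g)) -
          g * expect p (fun G => (1 - p : ℝ) ^ survivors G s (insert u (insert w X)) - g) := by
        rw [h1, ← expect_const_mul, ← expect_const_mul, ← expect_sub, ← expect_sub]
        congr 1
        ext G
        ring
    _ = _ := by
        rw [h2, ← expect_const_mul, ← expect_sub]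
        congr 1
        ext G
        ring

theorem mul_le_mul_add_abs_sub {a b a' b' : ℝ} (hb : |b| ≤ 1) (ha' : |a'| ≤ 1) :
    a * b ≤ a' * b' + (|a - a'| + |b - b'|) := by
  have h1 : (a - a') * b ≤ |a - a'| := (le_abs_self _).trans (by
    rw [abs_mul]
    exact mul_le_of_le_one_right (abs_nonneg _) hb)
  have h2 : a' * (b - b') ≤ |b - b'| := (le_abs_self _).trans (by
    rw [abs_mul]
    exact mul_le_of_le_one_left (abs_nonneg _) ha')
  linarith

theorem abs_ind_sub_le_one (P : Prop) {g : ℝ} (hg : 0 ≤ g) (hg' : g ≤ 1) : |ind P - g| ≤ 1 := by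
  rw [abs_le]
  constructor <;> linarith [ind_nonneg P, ind_le_one P]

theorem abs_one_sub_pow_sub_le_one (k : ℕ) {g : ℝ} (hg : 0 ≤ g) (hg' : g ≤ 1) :
    |(1 - p : ℝ) ^ k - g| ≤ 1 := by
  have h0 : (0 : ℝ) ≤ 1 - p := by linarith [p.2.2]
  have h1 : (1 - p : ℝ) ^ k ≤ 1 := pow_le_one₀ h0 (by linarith [p.2.1])
  rw [abs_le]
  constructor <;> linarith [pow_nonneg h0 k]

/-- The events that the branches at two vertices die are almost uncorrelated. -/
theorem expect_pair_le {C : ℝ} (hC : Fintype.card V * (p : ℝ) ≤ C) (hC0 : 0 ≤ C) {s : ℕ}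
    {X : Finset V} {u w : V} (hu : u ∉ X) (hw : w ∉ X) (huw : u ≠ w) {g δ : ℝ} (hg : 0 ≤ g)
    (hg' : g ≤ 1)
    (h : expect p (fun G => |(1 - p : ℝ) ^ survivors G s (insert u (insert w X)) - g|) ≤ δ) :
    expect p (fun G => (ind (Dies G (s + 1) X u) - g) * (ind (Dies G (s + 1) X w) - g)) ≤
      δ + 2 * ((1 + C) ^ (s + 1) * p) := by
  calc _ ≤ expect p (fun G => (ind (Dies G (s + 1) (insert w X) u) - g) *
            (ind (Dies G (s + 1) (insert u X) w) - g) +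
          (ind (¬ (Dies G (s + 1) X u ↔ Dies G (s + 1) (insert w X) u)) +
            ind (¬ (Dies G (s + 1) X w ↔ Dies G (s + 1) (insert u X) w)))) := by
        refine expect_mono fun G => ?_
        rw [← abs_ind_sub_ind, ← abs_ind_sub_ind]
        convert mul_le_mul_add_abs_sub (abs_ind_sub_le_one _ hg hg')
          (abs_ind_sub_le_one _ hg hg') using 4 <;> ring
    _ ≤ δ + ((1 + C) ^ (s + 1) * p + (1 + C) ^ (s + 1) * p) := by
        rw [expect_add, expect_add, expect_pair_eq hw huw]
        refine add_le_add (le_trans (expect_mono fun G => ?_) h) (add_le_add ?_ ?_)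
        · rw [← sq_abs, sq]
          exact mul_le_of_le_one_left (abs_nonneg _) (abs_one_sub_pow_sub_le_one _ hg hg')
        · exact expect_dies_insert_ne_le hC hC0 _ hu huw
        · exact expect_dies_insert_ne_le hC hC0 _ hw huw.symm
    _ = _ := by ring

theorem expect_sq_sum_le {U : Finset V} {Y : V → SimpleGraph V → ℝ} {B : ℝ} (hB : 0 ≤ B)
    (hY : ∀ u ∈ U, ∀ G, |Y u G| ≤ 1)
    (h : ∀ u ∈ U, ∀ w ∈ U, u ≠ w → expect p (fun G => Y u G * Y w G) ≤ B) :
    expect p (fun G => (∑ u ∈ U, Y u G) ^ 2) ≤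
      (Fintype.card V : ℝ) ^ 2 * B + Fintype.card V := by
  have hterm : ∀ u ∈ U, ∀ w ∈ U, expect p (fun G => Y u G * Y w G) ≤
      B + if u = w then 1 else 0 := by
    intro u hu w hw
    split_ifs with huw
    · subst huw
      refine (expect_mono (g := fun _ => 1) fun G => ?_).trans ?_
      · rw [← sq, ← sq_abs]
        exact pow_le_one₀ (abs_nonneg _) (hY u hu G)
      · rw [expect_const]
        linarith
    · simpa using h u hu w hw huw
  have hU : (U.card : ℝ) ≤ Fintype.card V := by exact_mod_cast Finset.card_le_univ U
  calc _ = ∑ u ∈ U, ∑ w ∈ U, expect p (fun G => Y u G * Y w G) := by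
        simp only [sq, Finset.sum_mul_sum, expect_sum]
    _ ≤ ∑ u ∈ U, ∑ w ∈ U, (B + if u = w then (1 : ℝ) else 0) :=
        Finset.sum_le_sum fun u hu => Finset.sum_le_sum fun w hw => hterm u hu w hw
    _ = (U.card : ℝ) ^ 2 * B + U.card := by
        simp only [Finset.sum_add_distrib, Finset.sum_const, Finset.sum_ite_eq, nsmul_eq_mul,
          Finset.sum_ite_mem, Finset.inter_self, mul_one]
        ring
    _ ≤ _ := by gcongr

end Pairs

/-- Second moment method: the centred indicators have small pairwise correlations, so their sum `Y`
has second moment `o(n²)` for small `δ`, and `|x| ≤ x² / η + η` turns this into a first moment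
bound. The last term accounts for the vertices of `X`, which are not counted. -/
theorem expect_abs_survivors_succ_le (hn : 0 < n) (hcn : (c : ℝ) ≤ n) {s : ℕ}
    {X : Finset (Fin n)} {δ η : ℝ} (hη : 0 < η) (hδ : 0 ≤ δ)
    (h : ∀ u ∉ X, ∀ w ∉ X, u ≠ w → expect (edgeProb c n) (fun G =>
      |(1 - edgeProb c n : ℝ) ^ survivors G s (insert u (insert w X)) - gamma c (s + 1)|) ≤ δ) :
    expect (edgeProb c n)
      (fun G => |(survivors G (s + 1) X : ℝ) / n - (1 - gamma c (s + 1))|) ≤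
        (δ + 2 * ((1 + c) ^ (s + 1) * (c / n)) + 1 / n) / η + η + X.card / n := by
  have hn' : (0 : ℝ) < n := by exact_mod_cast hn
  have hp := coe_edgeProb hcn
  set p := edgeProb c n
  set g := gamma c (s + 1) with hgdef
  have hg : 0 ≤ g := gamma_nonneg c _
  have hg' : g ≤ 1 := gamma_le_one c _
  set Y : SimpleGraph (Fin n) → ℝ := fun G => ∑ u ∈ Xᶜ, (ind (Dies G (s + 1) X u) - g) with hY
  set B := δ + 2 * ((1 + (c : ℝ)) ^ (s + 1) * (c / n)) with hBdef
  have hB : 0 ≤ B := by positivity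
  have hsq : expect p (fun G => Y G ^ 2) ≤ (n : ℝ) ^ 2 * B + n := by
    have := expect_sq_sum_le (p := p) (U := Xᶜ)
      (Y := fun u G => ind (Dies G (s + 1) X u) - g) hB
      (fun u _ G => abs_ind_sub_le_one _ hg hg') fun u hu w hw huw => ?_
    · rwa [Fintype.card_fin] at this
    · rw [Finset.mem_compl] at hu hw
      have hC : (Fintype.card (Fin n) : ℝ) * p ≤ c := by
        rw [hp, Fintype.card_fin, mul_div_cancel₀ _ hn'.ne']
      have := expect_pair_le hC c.2 hu hw huw hg hg' (h u hu w hw huw)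
      rwa [hp] at this
  have hpt : ∀ G : SimpleGraph (Fin n), |(survivors G (s + 1) X : ℝ) / n - (1 - g)| ≤
      (1 / (n ^ 2 * η)) * Y G ^ 2 + (η + X.card / n) := by
    intro G
    have hcard : ((Xᶜ).card : ℝ) = n - X.card := by
      rw [Finset.card_compl, Fintype.card_fin, Nat.cast_sub (by simpa using Finset.card_le_univ X)]
    have hZ : (survivors G (s + 1) X : ℝ) = n * (1 - g) - Y G - X.card * (1 - g) := by
      rw [survivors_eq_sum, hY]
      simp only [ind_not, Finset.sum_sub_distrib, Finset.sum_const, nsmul_eq_mul, hcard]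
      ring
    have h1 : (survivors G (s + 1) X : ℝ) / n - (1 - g) = -(Y G / n) - X.card / n * (1 - g) := by
      rw [hZ]
      field_simp
      ring
    have h2 : |X.card / n * (1 - g)| ≤ (X.card : ℝ) / n := by
      rw [abs_of_nonneg (mul_nonneg (by positivity) (by linarith))]
      exact mul_le_of_le_one_right (by positivity) (by linarith)
    have h3 : |Y G / n| ≤ (1 / (n ^ 2 * η)) * Y G ^ 2 + η := by
      have h4 : (1 / (n ^ 2 * η)) * Y G ^ 2 = |Y G / n| ^ 2 / η := by
        rw [sq_abs]
        field_simp
      rw [h4, ← sub_le_iff_le_add, le_div_iff₀ hη]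
      nlinarith [sq_nonneg (|Y G / n| - η / 2), abs_nonneg (Y G / n)]
    rw [h1]
    have h5 := abs_sub (-(Y G / n)) (X.card / n * (1 - g))
    rw [abs_neg] at h5
    linarith
  refine (expect_mono hpt).trans ?_
  rw [expect_add, expect_const_mul, expect_const]
  calc _ ≤ 1 / (n ^ 2 * η) * ((n : ℝ) ^ 2 * B + n) + (η + X.card / n) := by gcongr
    _ = _ := by
      field_simp
      ring

/-- The proportion of vertices whose branches survive concentrates around its limit. -/
theorem eventually_expect_abs_survivors_le (c : ℝ≥0) (s K : ℕ) {ε : ℝ} (hε : 0 < ε) :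
    ∀ᶠ n : ℕ in atTop, ∀ X : Finset (Fin n), X.card ≤ K →
      expect (edgeProb c n) (fun G => |(survivors G s X : ℝ) / n - (1 - gamma c s)|) ≤ ε := by
  induction s generalizing K ε with
  | zero =>
    have hlim := tendsto_const_div_atTop_nhds_zero_nat (K : ℝ)
    filter_upwards [hlim.eventually_le_const hε, eventually_gt_atTop 0] with n hn hn0 X hX
    have hn' : (0 : ℝ) < n := by exact_mod_cast hn0
    refine le_trans ?_ hn
    rw [← expect_const (V := Fin n) (p := edgeProb c n) ((K : ℝ) / n)]
    refine expect_mono fun G => ?_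
    have hcard : (survivors G 0 X : ℝ) = n - X.card := by
      rw [survivors_eq_sum]
      simp only [Dies, not_false_iff]
      rw [ind_of trivial, Finset.sum_const, Finset.card_compl, Fintype.card_fin, nsmul_eq_mul,
        Nat.cast_sub (by simpa using Finset.card_le_univ X), mul_one]
    rw [hcard, gamma, sub_div, div_self hn'.ne', sub_zero, sub_sub_cancel_left, abs_neg,
      abs_of_nonneg (by positivity)]
    gcongr
  | succ s ih =>
    set η := ε / 2 with hη
    have hη0 : 0 < η := by positivity
    -- Chosen so that `c * δ / η ≤ ε / 4`; `c + 1` replaces `c` to keep the quotient harmless. All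
    -- errors of order `1/n` are collected in `A / n`.
    set δ := ε * η / (4 * (c + 1)) with hδ
    have hδ0 : 0 < δ := by positivity
    set A : ℝ := (c ^ 2 + 2 * ((1 + c) ^ (s + 1) * c) + 1) / η + K with hA
    have hlim := tendsto_const_div_atTop_nhds_zero_nat A
    -- The pair estimate deletes two more vertices, hence `K + 2`: the induction needs uniformity
    -- over all `X` of bounded size.
    filter_upwards [ih (K + 2) hδ0, hlim.eventually_le_const (show 0 < ε / 4 by positivity),
      eventually_gt_atTop 0, eventually_ge_atTop ⌈(c : ℝ)⌉₊] with n hn hnA hn0 hnc X hX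
    have hn' : (0 : ℝ) < n := by exact_mod_cast hn0
    have hcn : (c : ℝ) ≤ n := Nat.ceil_le.1 hnc
    refine (expect_abs_survivors_succ_le hn0 hcn (δ := c * δ + c ^ 2 / n) hη0 (by positivity)
      fun u _ w _ _ => expect_pow_survivors_sub_le hn0 hcn (hn _ ?_)).trans ?_
    · have h1 := Finset.card_insert_le u (insert w X)
      have h2 := Finset.card_insert_le w X
      omega
    · have hXK : (X.card : ℝ) ≤ K := by exact_mod_cast hX
      have hcδ : c * δ / η ≤ ε / 4 := by
        rw [div_le_iff₀ hη0, hδ, ← mul_div_assoc, div_le_iff₀ (by positivity)]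
        have : 0 ≤ ε * η := by positivity
        nlinarith [c.2]
      calc _ ≤ (c * δ + c ^ 2 / n + 2 * ((1 + c) ^ (s + 1) * (c / n)) + 1 / n) / η + η +
            (K : ℝ) / n := by gcongr
        _ = c * δ / η + η + A / n := by
          rw [hA]
          field_simp
          ring
        _ ≤ ε / 4 + η + ε / 4 := by gcongr
        _ = ε := by rw [hη]; ring

end Concentration

/-! ### Limiting probabilities at a single vertex -/

section Root

section SingleBranch

variable {V : Type*} [Fintype V] [DecidableEq V] {p : unitInterval}

/-- The witness is unique, since every other branch dies within `s` rounds and so within `s + 1`.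
The union over `w` is therefore disjoint and the indicator is an exact sum. -/
theorem ind_hasSingleBranch (G : SimpleGraph V) (s : ℕ) (v : V) :
    ind (HasSingleBranch G s v) = ∑ w ∈ ({v} : Finset V)ᶜ, ind (G.Adj v w) *
      (ind (∀ y ∈ ({v, w} : Finset V)ᶜ, G.Adj v y → Dies G s {v} y) *
        ind (¬ Dies G (s + 1) {v} w)) := by
  by_cases h : HasSingleBranch G s v
  · obtain ⟨w, hvw, hw, huniq⟩ := h
    rw [ind_of ⟨w, hvw, hw, huniq⟩, Finset.sum_eq_single w]
    · rw [ind_of hvw, ind_of hw, ind_of, one_mul, one_mul]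
      exact fun y hy hadj => huniq y hadj fun e => by simp [e] at hy
    · intro z _ hzw
      by_cases hvz : G.Adj v z
      · rw [ind_of_not (not_not.2 (huniq z hvz hzw).succ), mul_zero, mul_zero]
      · rw [ind_of_not hvz, zero_mul]
    · intro hv
      exact absurd hvw (by simp at hv; simp [hv])
  · rw [ind_of_not h, Finset.sum_eq_zero]
    intro w _
    by_cases hvw : G.Adj v w
    · by_cases hw : Dies G (s + 1) {v} w
      · rw [ind_of_not (not_not.2 hw), mul_zero, mul_zero]
      · have hall : ¬ ∀ y ∈ ({v, w} : Finset V)ᶜ, G.Adj v y → Dies G s {v} y := fun hall =>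
          h ⟨w, hvw, hw, fun y hy hyw => hall y (by simp [hy.ne', hyw]) hy⟩
        rw [ind_of_not hall, zero_mul, mul_zero]
    · rw [ind_of_not hvw, zero_mul]

theorem abs_pow_sub_pow_succ_le {x : ℝ} (hx : 0 ≤ x) (hx' : x ≤ 1) {a b : ℕ} (hab : a ≤ b)
    (hba : b ≤ a + 1) : |x ^ a - x ^ b| ≤ 1 - x := by
  obtain rfl | rfl : b = a ∨ b = a + 1 := by omega
  · simpa using hx'
  · rw [pow_succ, ← mul_one_sub, abs_of_nonneg (mul_nonneg (pow_nonneg hx a) (by linarith))]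
    exact mul_le_of_le_one_left (by linarith) (pow_le_one₀ hx hx')

/-- First `vw` is exposed, then the other edges at `v`. Leaving `w` out of the count of survivors
lowers the exponent by at most one, an error of at most `p` for each of at most `n` terms of weight
`p`. -/
theorem abs_expect_hasSingleBranch_sub_le (s : ℕ) (v : V) :
    |expect p (fun G => ind (HasSingleBranch G s v)) -
      expect p (fun G => (p : ℝ) * survivors G (s + 1) {v} * (1 - p : ℝ) ^ survivors G s {v})| ≤
        Fintype.card V * (p : ℝ) ^ 2 := by
  classical
  have hp := p.2.1
  have hp' := p.2.2
  let N : V → SimpleGraph V → ℕ := fun w G =>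
    (({v, w} : Finset V)ᶜ.filter fun y => ¬ Dies G s {v} y).card
  have hterm : ∀ w ∈ ({v} : Finset V)ᶜ, expect p (fun G => ind (G.Adj v w) *
      (ind (∀ y ∈ ({v, w} : Finset V)ᶜ, G.Adj v y → Dies G s {v} y) *
        ind (¬ Dies G (s + 1) {v} w))) =
      p * expect p (fun G => (1 - p : ℝ) ^ N w G * ind (¬ Dies G (s + 1) {v} w)) := by
    intro w hw
    have hwv : w ≠ v := by simpa using hw
    have hwv' : w ∉ ({v} : Finset V) := by simpa using hwv
    have hy' : ∀ y ∈ ({v, w} : Finset V)ᶜ, y ≠ v ∧ y ≠ w := fun y hy => by simpa using hy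
    rw [expect_adj_mul hwv.symm]
    · congr 1
      convert expect_forall_adj_mul (p := p) (v := v) (U := ({v, w} : Finset V)ᶜ) (by simp)
        (Q := fun y G => Dies G s {v} y) (f := fun G => ind (¬ Dies G (s + 1) {v} w))
        (fun y hy z _ => ignoresEdge_dies (by simpa using (hy' y hy).1) (by simp))
        (fun z _ => (ignoresEdge_dies hwv' (by simp)).comp fun P => ind (¬ P)) using 4
    · refine IgnoresEdge.comp₂ (fun G H h => ?_) (ignoresEdge_dies hwv' (by simp))
        (fun (P Q : Prop) => ind P * ind (¬ Q))
      refine propext (forall₂_congr fun y hy => ?_)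
      have h1 := h v y (by
        rw [ne_eq, Sym2.eq_iff]
        rintro (⟨-, e⟩ | ⟨e, -⟩)
        · exact (hy' y hy).2 e
        · exact hwv e.symm)
      have h2 : Dies G s {v} y = Dies H s {v} y :=
        ignoresEdge_dies (by simpa using (hy' y hy).1) (by simp) G H h
      rw [h1, h2]
  have hN : ∀ w ∈ ({v} : Finset V)ᶜ, ∀ G, |(1 - p : ℝ) ^ N w G - (1 - p : ℝ) ^ survivors G s {v}|
      ≤ p := by
    intro w hw G
    have := abs_pow_sub_pow_succ_le (x := 1 - p) (a := N w G) (b := survivors G s {v})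
      (by linarith) (by linarith) ?_ ?_
    · simpa using this
    · refine (Finset.card_le_card ?_).trans_eq (by rw [survivors])
      intro y
      simp only [Finset.mem_filter, Finset.mem_compl, Finset.mem_insert, Finset.mem_singleton,
        not_or]
      tauto
    · have hsub : survivors G s {v} ≤ (insert w
          (({v, w} : Finset V)ᶜ.filter fun y => ¬ Dies G s {v} y)).card := by
        rw [survivors]
        refine Finset.card_le_card ?_
        intro y
        simp only [Finset.mem_filter, Finset.mem_compl, Finset.mem_insert, Finset.mem_singleton,
          not_or]
        tauto
      exact hsub.trans (Finset.card_insert_le _ _)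
  have hL : expect p (fun G => ind (HasSingleBranch G s v)) = ∑ w ∈ ({v} : Finset V)ᶜ,
      p * expect p (fun G => (1 - p : ℝ) ^ N w G * ind (¬ Dies G (s + 1) {v} w)) := by
    simp only [ind_hasSingleBranch]
    rw [expect_sum]
    exact Finset.sum_congr rfl hterm
  have hR : expect p (fun G => (p : ℝ) * survivors G (s + 1) {v} *
      (1 - p : ℝ) ^ survivors G s {v}) = ∑ w ∈ ({v} : Finset V)ᶜ,
      p * expect p (fun G =>
        (1 - p : ℝ) ^ survivors G s {v} * ind (¬ Dies G (s + 1) {v} w)) := by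
    simp only [← expect_const_mul]
    rw [← expect_sum]
    congr 1
    ext G
    rw [survivors_eq_sum, Finset.mul_sum, Finset.sum_mul]
    exact Finset.sum_congr rfl fun _ _ => by ring
  rw [hL, hR, ← Finset.sum_sub_distrib]
  refine (Finset.abs_sum_le_sum_abs _ _).trans ?_
  have hcard : ((({v} : Finset V)ᶜ).card : ℝ) ≤ Fintype.card V := by
    exact_mod_cast Finset.card_le_univ _
  calc _ ≤ ∑ w ∈ ({v} : Finset V)ᶜ, (p : ℝ) ^ 2 := by
        refine Finset.sum_le_sum fun w hw => ?_
        rw [← mul_sub, abs_mul, abs_of_nonneg hp, sq]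
        refine mul_le_mul_of_nonneg_left ((abs_expect_sub_le _ _).trans ?_) hp
        rw [← expect_const (V := V) (p := p) (p : ℝ)]
        refine expect_mono fun G => ?_
        rw [← sub_mul, abs_mul, abs_of_nonneg (ind_nonneg _), expect_const]
        exact (mul_le_of_le_one_right (abs_nonneg _) (ind_le_one _)).trans (hN w hw G)
    _ ≤ _ := by
        rw [Finset.sum_const, nsmul_eq_mul]
        gcongr

end SingleBranch

theorem eventually_abs_expect_dies_sub_le (c : ℝ≥0) (s : ℕ) {ε : ℝ} (hε : 0 < ε) :
    ∀ᶠ n : ℕ in atTop, ∀ v : Fin n, |expect (edgeProb c n) (fun G => ind (Dies G (s + 1) ∅ v)) -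
      gamma c (s + 1)| ≤ ε := by
  have hδ : 0 < ε / (2 * (c + 1)) := by positivity
  filter_upwards [eventually_expect_abs_survivors_le c s 1 hδ,
    (tendsto_const_div_atTop_nhds_zero_nat ((c : ℝ) ^ 2)).eventually_le_const (half_pos hε),
    eventually_gt_atTop 0, eventually_ge_atTop ⌈(c : ℝ)⌉₊] with n hn hnc hn0 hcn v
  rw [expect_dies_succ]
  refine (abs_expect_sub_const_le _ _).trans ((expect_pow_survivors_sub_le hn0
    (Nat.ceil_le.1 hcn) (hn _ (by simp))).trans ?_)
  have : c * (ε / (2 * (c + 1))) ≤ ε / 2 := by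
    rw [← mul_div_assoc, div_le_div_iff₀ (by positivity) (by positivity)]
    nlinarith [c.2]
  linarith

theorem eventually_abs_expect_hasSingleBranch_sub_le (c : ℝ≥0) (s : ℕ) {ε : ℝ} (hε : 0 < ε) :
    ∀ᶠ n : ℕ in atTop, ∀ v : Fin n,
      |expect (edgeProb c n) (fun G => ind (HasSingleBranch G s v)) -
        c * (1 - gamma c (s + 1)) * gamma c (s + 1)| ≤ ε := by
  -- The survivor count contributes an error `c δ` and the power `c · c δ`; together they are at
  -- most `(c + 1)² δ = ε / 2`.
  set δ : ℝ := ε / (2 * (c + 1) ^ 2) with hδdef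
  have hδ : 0 < δ := by positivity
  filter_upwards [eventually_expect_abs_survivors_le c s 1 hδ,
    eventually_expect_abs_survivors_le c (s + 1) 1 hδ,
    (tendsto_const_div_atTop_nhds_zero_nat ((c : ℝ) ^ 2 + c ^ 3)).eventually_le_const
      (half_pos hε),
    eventually_gt_atTop 0, eventually_ge_atTop ⌈(c : ℝ)⌉₊] with n hn hns hnc hn0 hcn v
  have hn' : (0 : ℝ) < n := by exact_mod_cast hn0
  have hcn' : (c : ℝ) ≤ n := Nat.ceil_le.1 hcn
  have h1 := abs_expect_hasSingleBranch_sub_le (p := edgeProb c n) s v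
  have h2 := expect_pow_survivors_sub_le hn0 hcn' (hn {v} (by simp))
  have h3 := hns {v} (by simp)
  set g := gamma c (s + 1)
  have hg : 0 ≤ g := gamma_nonneg c _
  have hg' : g ≤ 1 := gamma_le_one c _
  have h4 : |expect (edgeProb c n) (fun G => (edgeProb c n : ℝ) * survivors G (s + 1) {v} *
      (1 - edgeProb c n : ℝ) ^ survivors G s {v}) - c * (1 - g) * g| ≤
        c * δ + c * (c * δ + c ^ 2 / n) := by
    refine (abs_expect_sub_const_le _ _).trans ?_
    calc _ ≤ expect (edgeProb c n) (fun G =>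
          c * |(survivors G (s + 1) {v} : ℝ) / n - (1 - g)| +
            c * |(1 - edgeProb c n : ℝ) ^ survivors G s {v} - g|) := by
          refine expect_mono fun G => ?_
          set x := (1 - edgeProb c n : ℝ) ^ survivors G s {v} with hx
          have hx0 : 0 ≤ x := pow_nonneg (by linarith [(edgeProb c n).2.2]) _
          have hx1 : x ≤ 1 := pow_le_one₀ (by linarith [(edgeProb c n).2.2])
            (by linarith [(edgeProb c n).2.1])
          rw [coe_edgeProb hcn', show (c : ℝ) / n * survivors G (s + 1) {v} * x - c * (1 - g) * g =
            c * ((survivors G (s + 1) {v} / n - (1 - g)) * x) + c * ((1 - g) * (x - g)) by ring]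
          refine (abs_add_le _ _).trans ?_
          rw [abs_mul, abs_mul, abs_mul, abs_mul, NNReal.abs_eq, abs_of_nonneg hx0,
            abs_of_nonneg (show 0 ≤ 1 - g by linarith)]
          gcongr
          · exact mul_le_of_le_one_right (abs_nonneg _) hx1
          · exact mul_le_of_le_one_left (abs_nonneg _) (by linarith)
      _ ≤ _ := by
          rw [expect_add, expect_const_mul, expect_const_mul]
          gcongr
  have h5 : (Fintype.card (Fin n) : ℝ) * (edgeProb c n : ℝ) ^ 2 = c ^ 2 / n := by
    rw [coe_edgeProb hcn', Fintype.card_fin]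
    field_simp
  rw [h5] at h1
  have h6 : c * δ + c * (c * δ) ≤ ε / 2 := by
    have : δ * (c + 1) ^ 2 = ε / 2 := by
      rw [hδdef]
      field_simp
    nlinarith [c.2, mul_nonneg hδ.le c.2]
  have h7 : ((c : ℝ) ^ 2 + c ^ 3) / n = c ^ 2 / n + c * (c ^ 2 / n) := by ring
  refine (abs_sub_le _ _ _).trans ((add_le_add h1 h4).trans ?_)
  linarith

theorem eventually_expect_not_treeLike_le (c : ℝ≥0) (s : ℕ) {ε : ℝ} (hε : 0 < ε) :
    ∀ᶠ n : ℕ in atTop, ∀ v : Fin n,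
      expect (edgeProb c n) (fun G => ind (¬ TreeLike G s ∅ v v)) ≤ ε := by
  filter_upwards [(tendsto_const_div_atTop_nhds_zero_nat
      ((s : ℝ) * (1 + c) ^ s * c)).eventually_le_const hε,
    eventually_gt_atTop 0, eventually_ge_atTop ⌈(c : ℝ)⌉₊] with n hn hn0 hcn v
  have hn' : (0 : ℝ) < n := by exact_mod_cast hn0
  have hcn' : (c : ℝ) ≤ n := Nat.ceil_le.1 hcn
  have h := expect_not_treeLike_le (p := edgeProb c n) (c := c) (by
    rw [coe_edgeProb hcn', Fintype.card_fin, mul_div_cancel₀ _ hn'.ne']) c.2 s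
    (X := ∅) (x := v) (u := v) (by simp)
  rw [coe_edgeProb hcn', Finset.card_empty, Nat.cast_zero, zero_add, ← mul_div_assoc] at h
  exact h.trans hn

/-- The limiting probability that a vertex is non-isolated after `t` pruning phases, uniformly over
the choices made in the phases. -/
theorem eventually_abs_expect_nonIsolated_sub_le (c : ℝ≥0) (t : ℕ) {ε : ℝ} (hε : 0 < ε) :
    ∀ᶠ n : ℕ in atTop,
      ∀ R : SimpleGraph (Fin n) → PreAbstractSimplicialComplex (Fin n),
        (∀ G, IsPrunedTo t (cliqueComplex G) (R G)) → ∀ v : Fin n,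
          |expect (edgeProb c n) (fun G => ind (v ∈ nonIsolated (R G))) -
            (1 - gamma c (t + 1) - c * gamma c t + c * gamma c t ^ 2)| ≤ ε := by
  cases t with
  | zero =>
    -- Without pruning, `v` is isolated iff it dies in one round, and the terms in `γ_0 = 0` vanish.
    filter_upwards [eventually_abs_expect_dies_sub_le c 0 hε] with n hn R hR v
    have h : expect (edgeProb c n) (fun G => ind (v ∈ nonIsolated (R G))) =
        1 - expect (edgeProb c n) (fun G => ind (Dies G 1 ∅ v)) := by
      rw [← expect_const (V := Fin n) (p := edgeProb c n) 1, ← expect_sub]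
      congr 1
      ext G
      rw [show R G = cliqueComplex G from hR G, mem_nonIsolated_cliqueComplex_iff, ind_not]
    have h0 : gamma c 0 = 0 := rfl
    rw [h, h0, abs_sub_comm]
    convert hn v using 2
    ring
  | succ s =>
    have hε3 : 0 < ε / 3 := by positivity
    filter_upwards [eventually_abs_expect_dies_sub_le c (s + 1) hε3,
      eventually_abs_expect_hasSingleBranch_sub_le c s hε3,
      eventually_expect_not_treeLike_le c (s + 3) hε3] with n h1 h2 h3 R hR v
    have h4 : |expect (edgeProb c n) (fun G => ind (v ∈ nonIsolated (R G))) -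
        expect (edgeProb c n) (fun G => 1 - ind (Dies G (s + 2) ∅ v) -
          ind (HasSingleBranch G s v))| ≤ ε / 3 := by
      refine ((abs_expect_sub_le _ _).trans (expect_mono fun G => ?_)).trans (h3 v)
      -- The two exceptional events are disjoint, so their indicators are simply subtracted; the
      -- equivalence of `mem_nonIsolated_iff` then fails only off the tree-like event, whatever the
      -- choices in `R`.
      have hdisj : Dies G (s + 2) ∅ v → ¬ HasSingleBranch G s v := by
        rintro hd ⟨w, hvw, hw, -⟩
        exact hw (by simpa using hd w hvw (by simp))
      have h5 : 1 - ind (Dies G (s + 2) ∅ v) - ind (HasSingleBranch G s v) =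
          ind (¬ Dies G (s + 2) ∅ v ∧ ¬ HasSingleBranch G s v) := by
        by_cases hd : Dies G (s + 2) ∅ v
        · simp [ind, hd, hdisj hd]
        · by_cases hs : HasSingleBranch G s v <;> simp [ind, hd, hs]
      rw [h5]
      by_cases ht : TreeLike G (s + 3) ∅ v v
      · rw [mem_nonIsolated_iff (hR G) ht, sub_self, abs_zero]
        exact ind_nonneg _
      · rw [ind_of ht, abs_ind_sub_ind]
        exact ind_le_one _
    rw [expect_sub, expect_sub, expect_const] at h4
    have h1 := h1 v
    have h2 := h2 v
    rw [abs_le] at h1 h2 h4 ⊢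
    constructor <;> nlinarith

theorem expectER_ncard_nonIsolated_eq_sum (c : ℝ≥0) (n : ℕ)
    (R : SimpleGraph (Fin n) → PreAbstractSimplicialComplex (Fin n)) :
    expectER c n (fun G => ((nonIsolated (R G)).ncard : ℝ)) =
      ∑ v, expect (edgeProb c n) (fun G => ind (v ∈ nonIsolated (R G))) := by
  classical
  rw [expectER, integral_binomialRandom, ← expect_sum]
  congr 1
  ext G
  simp [ind, Set.ncard_eq_toFinset_card']

theorem isLittleO_expectER_nonIsolated (c : ℝ≥0) (t : ℕ)
    (R : (n : ℕ) → SimpleGraph (Fin n) → PreAbstractSimplicialComplex (Fin n))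
    (hR : ∀ n G, IsPrunedTo t (cliqueComplex G) (R n G)) :
    (fun n : ℕ => expectER c n (fun G => ((nonIsolated (R n G)).ncard : ℝ)) -
      (1 - gamma c (t + 1) - c * gamma c t + c * gamma c t ^ 2) * n)
        =o[atTop] fun n : ℕ => (n : ℝ) := by
  rw [isLittleO_iff]
  intro ε hε
  filter_upwards [eventually_abs_expect_nonIsolated_sub_le c t hε] with n hn
  set a := 1 - gamma c (t + 1) - c * gamma c t + c * gamma c t ^ 2
  have ha : a * n = ∑ _v : Fin n, a := by simp [mul_comm]
  rw [expectER_ncard_nonIsolated_eq_sum, ha, ← Finset.sum_sub_distrib, Real.norm_eq_abs,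
    Real.norm_natCast]
  refine (Finset.abs_sum_le_sum_abs _ _).trans
    ((Finset.sum_le_sum fun v _ => hn (R n) (hR n) v).trans_eq ?_)
  simp [mul_comm]

end Root

end StrongCollapse

open StrongCollapse in
theorem theorem3 (c : ℝ≥0) (hc : 0 < c) (t : ℕ) :
    (gamma c 0 = 0 ∧ ∀ s : ℕ, gamma c (s + 1) = Real.exp (-(c : ℝ) * (1 - gamma c s))) ∧
    ((fun n : ℕ =>
        expectER c n (fun G => ((nonIsolated (prune^[t] (cliqueComplex G))).ncard : ℝ))
          - (1 - gamma c (t + 1) - c * gamma c t + c * gamma c t ^ 2) * n)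
      =o[atTop] fun n : ℕ => (n : ℝ)) ∧
    ∀ R : (n : ℕ) → SimpleGraph (Fin n) → PreAbstractSimplicialComplex (Fin n),
      (∀ n G, IsPrunedTo t (cliqueComplex G) (R n G)) →
      ((fun n : ℕ =>
          expectER c n (fun G => ((nonIsolated (R n G)).ncard : ℝ))
            - (1 - gamma c (t + 1) - c * gamma c t + c * gamma c t ^ 2) * n)
        =o[atTop] fun n : ℕ => (n : ℝ)) :=
  ⟨⟨rfl, gamma_succ c⟩,
    isLittleO_expectER_nonIsolated c t (fun _ G => prune^[t] (cliqueComplex G))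
      fun _ G => isPrunedTo_iterate_prune (cliqueComplex G) t,
    isLittleO_expectER_nonIsolated c t⟩
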